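/- Let $K\ge 1$, $\mathcal A=\{1,\dots,K\}$ and $\Sigma=\mathcal A^{\mathbb N}$, with the metric $\rho(x,y)=K^{-\min\{n\ge 0:\,x_n\ne y_n\}}$ for $x\ne y$, $\rho(x,x)=0$, and the shift $(\sigma x)_i=x_{i+1}$. Let $A$ be a $K\times K$ matrix with entries in $\{0,1\}$ that is irreducible, i.e. for all $i,j$ there is $r>0$ with $(A^r)_{i,j}>0$, and let $$\Sigma_A=\{x\in\Sigma: A_{x_i,x_{i+1}}=1\text{ for every } i\in\mathbb N\}.$$ For $\omega\in\Sigma_A$ let $\mathrm{ML}_\omega(\Sigma_A,\sigma)$ be the set of all $y\in\Sigma_A$ such that $(\omega,y)$ is a mean Li–Yorke pair, that is, $$\liminf_{n\to\infty}\frac1n\sum_{i=0}^{n-1}\rho(\sigma^i\omega,\sigma^iy)=0\quad\text{and}\quad\limsup_{n\to\infty}\frac1n\sum_{i=0}^{n-1}\rho(\sigma^i\omega,\sigma^iy)>0 .$$ For a finite word $W$ of length $|W|\geq 1$ let $[W]\subset\Sigma$ be the cylinder of the sequences beginning with $W$. For $Z\subset\Sigma$, $s\ge0$ and $N\in\mathbb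 N$ put: * $\mathcal H^s_N(Z)=\inf_{\mathcal W}\sum_{W\in\mathcal W}e^{-s|W|}$ over all covers $\mathcal W$ of $Z$ by cylinders of words of length larger than $N$; $\mathcal H^s(Z)=\lim_{N\to\infty}\mathcal H^s_N(Z)$; the Bowen entropy is $h^B(Z)=\inf\{s\ge0:\mathcal H^s(Z)=0\}$. * $\mathcal P^s_N(Z)=\sup_{\mathcal W}\sum_{W\in\mathcal W}e^{-s|W|}$ over all families $\mathcal W$ of words of length at least $N$ whose cylinders are pairwise disjoint and meet $Z$; $\mathcal P^s_*(Z)=\lim_{N\to\infty}\mathcal P^s_N(Z)$; $\mathcal P^s(Z)=\inf\{\sum_{i\in\mathbb N}\mathcal P^s_*(Z_i):\bigcup_{i\in\mathbb N} Z_i\supset Z\}$; the packing entropy is $h^P(Z)=\inf\{s\ge0:\mathcal P^s(Z)=0\}$. Let $h(\Sigma_A)$ be the topological entropy of $(\Sigma_A,\sigma)$, that is, $\lim_{\epsilon\to0}\limsup_{n\to\infty}\frac1n\log r_n(\epsilon)$, where $r_n(\epsilon)$ is the least number of balls of radius $\epsilon$ for the metric $\max_{0\le i<n}\rho(\sigma^ix,\sigma^iy)$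 that cover $\Sigma_A$. Let $\dim_H$ and $\dim_P$ be the Hausdorff and packing dimensions with respect to $\rho$ (the packing dimension being the infimum of the $s\ge0$ for which the $s$-dimensional packing measure, built from disjoint closed balls centred in the set, each weighted by the $s$-th power of twice its radius, vanishes). **Theorem 1.2.** For every $\omega\in\Sigma_A$, $$h^B(\mathrm{ML}_\omega(\Sigma_A,\sigma))=0\quad\text{and}\quad h^P(\mathrm{ML}_\omega(\Sigma_A,\sigma))=h(\Sigma_A),$$ and, equivalently in terms of dimensions, $$\dim_H(\mathrm{ML}_\omega(\Sigma_A,\sigma))=0\quad\text{and}\quad\dim_P(\mathrm{ML}_\omega(\Sigma_A,\sigma))=\dim_H(\Sigma_A).$$ -/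

import Mathlib

open scoped ENNReal NNReal

noncomputable section

namespace SymbolicSpace

/-! ### The full shift, its metric and its shift map -/

/-- The space `Σ = 𝒜^ℕ` of one-sided sequences over an alphabet `𝒜` of `K` symbols.
It is a type synonym, so that it carries exactly the metric below (and its topology). -/
def FullShift (K : ℕ) : Type := ℕ → Fin K

/-- `ρ(x, y) = K ^ (-min {n ≥ 0 : x_n ≠ y_n})` for `x ≠ y`, and `ρ(x, x) = 0`.
For `x ≠ y`, the number `PiNat.firstDiff x y` is the least `n` with `x n ≠ y n`. -/
def FullShift.rho {K : ℕ} (x y : FullShift K) : ℝ :=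
  open scoped Classical in
  if x = y then 0 else ((K : ℝ) ^ PiNat.firstDiff (E := fun _ => Fin K) x y)⁻¹

theorem FullShift.one_le_card {K : ℕ} (x : FullShift K) : (1 : ℝ) ≤ K := by
  have h : 0 < K := (x 0).pos
  exact_mod_cast h

theorem FullShift.rho_nonneg {K : ℕ} (x y : FullShift K) : 0 ≤ FullShift.rho x y := by
  unfold FullShift.rho
  split_ifs <;> positivity

theorem FullShift.rho_ultra {K : ℕ} (x y z : FullShift K) :
    FullShift.rho x z ≤ max (FullShift.rho x y) (FullShift.rho y z) := by
  by_cases hxz : x = z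
  · have h0 : FullShift.rho x z = 0 := by simp [FullShift.rho, hxz]
    rw [h0]
    exact le_max_of_le_left (FullShift.rho_nonneg x y)
  by_cases hxy : x = y
  · subst hxy
    exact le_max_right _ _
  by_cases hyz : y = z
  · subst hyz
    exact le_max_left _ _
  have hK : (1 : ℝ) ≤ K := FullShift.one_le_card x
  have hmin := PiNat.min_firstDiff_le (E := fun _ => Fin K) x y z hxz
  have key : ∀ {m n : ℕ}, m ≤ n → ((K : ℝ) ^ n)⁻¹ ≤ ((K : ℝ) ^ m)⁻¹ := by
    intro m n hmn
    have hpos : (0 : ℝ) < (K : ℝ) ^ m := pow_pos (by linarith) m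
    exact inv_anti₀ hpos (pow_le_pow_right₀ hK hmn)
  simp only [FullShift.rho, hxz, hxy, hyz, if_false]
  rcases min_le_iff.mp hmin with h | h
  · exact le_max_of_le_left (key h)
  · exact le_max_of_le_right (key h)

instance FullShift.instMetricSpace (K : ℕ) : MetricSpace (FullShift K) where
  dist := FullShift.rho
  dist_self x := by simp [FullShift.rho]
  dist_comm x y := by
    by_cases h : x = y
    · simp [FullShift.rho, h]
    · simp only [FullShift.rho, h, Ne.symm h, if_false,
        PiNat.firstDiff_comm (E := fun _ => Fin K) x y]
  dist_triangle x y z := (FullShift.rho_ultra x y z).trans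
    (max_le_add_of_nonneg (FullShift.rho_nonneg x y) (FullShift.rho_nonneg y z))
  eq_of_dist_eq_zero {x y} h := by
    by_contra hxy
    have hK : (1 : ℝ) ≤ K := FullShift.one_le_card x
    have h' : FullShift.rho x y = 0 := h
    simp only [FullShift.rho, hxy, if_false] at h'
    have hpos : (0 : ℝ) < ((K : ℝ) ^ PiNat.firstDiff (E := fun _ => Fin K) x y)⁻¹ :=
      inv_pos.mpr (pow_pos (by linarith) _)
    linarith

/-- The shift map `(σ x)_i = x_{i+1}`. -/
def shift {K : ℕ} (x : FullShift K) : FullShift K := fun i => x (i + 1)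

/-- The shift of finite type `Σ_A = {x : A_{x_i, x_{i+1}} = 1 for every i}`. -/
def sft {K : ℕ} (A : Matrix (Fin K) (Fin K) ℕ) : Set (FullShift K) :=
  {x | ∀ i : ℕ, A (x i) (x (i + 1)) = 1}

/-- The cylinder `[W]` of a finite word `W`: the sequences that begin with `W`. -/
def cylinder {K : ℕ} (W : List (Fin K)) : Set (FullShift K) :=
  {x | ∀ i : Fin W.length, x i = W.get i}

/-! ### Mean Li-Yorke pairs -/

/-- The mean distance `(1/n) ∑_{i<n} ρ(T^i x, T^i y)` of two orbits up to time `n`. -/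
def orbitMean {X : Type*} [MetricSpace X] (T : X → X) (x y : X) (n : ℕ) : ℝ :=
  (∑ i ∈ Finset.range n, dist (T^[i] x) (T^[i] y)) / n

/-- `(x, y)` is a mean Li-Yorke pair of the map `T` of a bounded metric space: the lower limit of
the mean distances is `0` and the upper limit is positive. -/
def IsMeanLiYorkePair {X : Type*} [MetricSpace X] (T : X → X) (x y : X) : Prop :=
  Filter.liminf (orbitMean T x y) Filter.atTop = 0 ∧
    0 < Filter.limsup (orbitMean T x y) Filter.atTop

/-- `ML_ω(Σ_A, σ)`: the points of `Σ_A` that form a mean Li-Yorke pair with `ω`. -/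
def meanLiYorkeSet {K : ℕ} (A : Matrix (Fin K) (Fin K) ℕ) (ω : FullShift K) :
    Set (FullShift K) :=
  {y | y ∈ sft A ∧ IsMeanLiYorkePair shift ω y}

/-! ### Bowen entropy and packing entropy of a subset of the full shift -/

/-- `∑_{W ∈ 𝒲} e^{-s|W|}` for a family `𝒲` of words. -/
def wordSum {K : ℕ} (s : ℝ≥0) (𝒲 : Set (List (Fin K))) : ℝ≥0∞ :=
  ∑' W : 𝒲, ENNReal.ofReal (Real.exp (-((s : ℝ) * (W : List (Fin K)).length)))

/-- `ℋ^s_N(Z)`: infimum over the covers of `Z` by cylinders of length larger than `N`. -/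
def bowenPre {K : ℕ} (s : ℝ≥0) (N : ℕ) (Z : Set (FullShift K)) : ℝ≥0∞ :=
  ⨅ (𝒲 : Set (List (Fin K))) (_ : ∀ W ∈ 𝒲, N < W.length) (_ : Z ⊆ ⋃ W ∈ 𝒲, cylinder W),
    wordSum s 𝒲

/-- `ℋ^s(Z) = lim_{N → ∞} ℋ^s_N(Z)`, an increasing limit. -/
def bowenMeasure {K : ℕ} (s : ℝ≥0) (Z : Set (FullShift K)) : ℝ≥0∞ :=
  ⨆ N : ℕ, bowenPre s N Z

/-- The Bowen topological entropy `h^B(Z) = inf {s ≥ 0 : ℋ^s(Z) = 0}`. -/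
def bowenEntropy {K : ℕ} (Z : Set (FullShift K)) : ℝ≥0∞ :=
  ⨅ (s : ℝ≥0) (_ : bowenMeasure s Z = 0), (s : ℝ≥0∞)

/-- `𝒫^s_N(Z)`: supremum over the families of pairwise disjoint cylinders of (nonempty) words
of length at least `N` that meet `Z`. -/
def packingPre {K : ℕ} (s : ℝ≥0) (N : ℕ) (Z : Set (FullShift K)) : ℝ≥0∞ :=
  ⨆ (𝒲 : Set (List (Fin K)))
    (_ : ∀ W ∈ 𝒲, W ≠ [] ∧ N ≤ W.length ∧ (cylinder W ∩ Z).Nonempty)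
    (_ : 𝒲.PairwiseDisjoint cylinder), wordSum s 𝒲

/-- `𝒫^s_*(Z) = lim_{N → ∞} 𝒫^s_N(Z)`, a decreasing limit. -/
def packingPreLim {K : ℕ} (s : ℝ≥0) (Z : Set (FullShift K)) : ℝ≥0∞ :=
  ⨅ N : ℕ, packingPre s N Z

/-- `𝒫^s(Z) = inf {∑_i 𝒫^s_*(Z_i) : ⋃_i Z_i ⊇ Z}`. -/
def packingMeasure {K : ℕ} (s : ℝ≥0) (Z : Set (FullShift K)) : ℝ≥0∞ :=
  ⨅ (C : ℕ → Set (FullShift K)) (_ : Z ⊆ ⋃ i, C i), ∑' i, packingPreLim s (C i)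

/-- The packing entropy `h^P(Z) = inf {s ≥ 0 : 𝒫^s(Z) = 0}`. -/
def packingEntropy {K : ℕ} (Z : Set (FullShift K)) : ℝ≥0∞ :=
  ⨅ (s : ℝ≥0) (_ : packingMeasure s Z = 0), (s : ℝ≥0∞)

/-! ### Packing dimension of a subset of a metric space -/

/-- Supremum of `∑ (2r)^s` over the countable families of pairwise disjoint closed balls `B(x, r)`
with centres `x ∈ Z` and radii `0 < r ≤ δ`. A ball is recorded as the pair `(x, r)`. -/
def ballPackingPre {X : Type*} [MetricSpace X] (s : ℝ≥0) (δ : ℝ) (Z : Set X) : ℝ≥0∞ :=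
  ⨆ (P : Set (X × ℝ)) (_ : P.Countable) (_ : ∀ p ∈ P, p.1 ∈ Z ∧ 0 < p.2 ∧ p.2 ≤ δ)
    (_ : P.PairwiseDisjoint fun p => Metric.closedBall p.1 p.2),
    ∑' p : P, ENNReal.ofReal ((2 * (p : X × ℝ).2) ^ (s : ℝ))

/-- The `s`-dimensional packing premeasure, the decreasing limit as `δ → 0`. -/
def ballPackingPreLim {X : Type*} [MetricSpace X] (s : ℝ≥0) (Z : Set X) : ℝ≥0∞ :=
  ⨅ (δ : ℝ) (_ : 0 < δ), ballPackingPre s δ Z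

/-- The `s`-dimensional packing measure. -/
def ballPackingMeasure {X : Type*} [MetricSpace X] (s : ℝ≥0) (Z : Set X) : ℝ≥0∞ :=
  ⨅ (C : ℕ → Set X) (_ : Z ⊆ ⋃ i, C i), ∑' i, ballPackingPreLim s (C i)

/-- The packing dimension `dim_P`: infimum of the `s ≥ 0` with vanishing packing measure. -/
def dimP {X : Type*} [MetricSpace X] (Z : Set X) : ℝ≥0∞ :=
  ⨅ (s : ℝ≥0) (_ : ballPackingMeasure s Z = 0), (s : ℝ≥0∞)

end SymbolicSpace

end

open SymbolicSpace

/-!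
The lower bounds come from the Baire category theorem, the upper bounds from counting words.

*Counting.* If `(ω, y)` is a mean Li-Yorke pair then, for infinitely many `n`, the first `n` symbols
of `y` differ from those of `ω` at no more than `ε n` places. A Chernoff bound shows that such words
have arbitrarily small exponential growth rate (`exists_ncard_nearWords_le`), and covering by them
gives Bowen entropy `0` (`bowenEntropy_meanLiYorkeSet`). The packing entropy of every subset of
`Σ_A` is at most the growth rate of all words (`packingEntropy_le_of_growth`), which is the
topological entropy (`eventually_ncard_prefixes_le`, `frequently_le_ncard_prefixes`).

*Category.* Let `E` be the closure of the set of points of `Σ_A` that eventually coincide with `ω`.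
By irreducibility `E` contains every point of `Σ_A` that meets `ω` at some time
(`exists_tailSet_agree`, which makes no use of the period of `A`). Consequently each cylinder
meeting `E` captures the full exponential growth of words (`frequently_exp_le_ncard_prefixes`).
If the topological entropy is positive, the mean Li-Yorke set is residual in `E`: the lower mean
distance vanishes on the points eventually equal to `ω`, and the upper mean distance is large on a
dense set since words near `ω` are too few. When a residual set is covered by countably many sets,
the closure of one of them contains a piece of `E`, whose packing premeasure is infinite below the
topological entropy (`packingMeasure_meanLiYorkeSet_eq_top`).

*Dimensions.* For `K ≥ 2` balls are cylinders, so entropies are `log K` times dimensions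
(`packingEntropy_eq_mul_dimP`, `bowenEntropy_eq_mul_dimH`). The Bowen entropy of `Σ_A` equals its
topological entropy (`bowenEntropy_sft`): by compactness a cover of small weight may be taken
finite, every long word is a concatenation of covering words, and this bounds the number of words
(`exists_ncard_prefixes_le`).
-/

namespace SymbolicSpace

open Filter Set
open scoped Topology

variable {K : ℕ}

/-! ### Prefixes, cylinders and the topology of the full shift -/

/-- The word formed by the first `n` symbols of `x`. -/
def FullShift.take (x : FullShift K) (n : ℕ) : List (Fin K) := List.ofFn fun i : Fin n => x i

/-- The words of length `n` that begin some point of `Z`. -/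
def prefixes (Z : Set (FullShift K)) (n : ℕ) : Set (List (Fin K)) := (fun x => x.take n) '' Z

@[simp] theorem FullShift.length_take (x : FullShift K) (n : ℕ) : (x.take n).length = n := by
  simp [FullShift.take]

theorem FullShift.take_eq_take {x y : FullShift K} {n : ℕ} :
    x.take n = y.take n ↔ ∀ i < n, x i = y i := by
  simp only [FullShift.take, List.ofFn_inj, funext_iff]
  exact ⟨fun h i hi => h ⟨i, hi⟩, fun h i => h i i.2⟩

theorem mem_cylinder_iff {x : FullShift K} {W : List (Fin K)} :
    x ∈ cylinder W ↔ x.take W.length = W := by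
  constructor
  · intro h
    refine List.ext_getElem (by simp) fun i h1 h2 => ?_
    simpa [FullShift.take] using h ⟨i, h2⟩
  · intro h i
    have h2 := List.getElem_of_eq h (i := i) (by simp)
    simpa [FullShift.take] using h2

theorem mem_cylinder_take {x y : FullShift K} {n : ℕ} :
    x ∈ cylinder (y.take n) ↔ ∀ i < n, x i = y i := by
  rw [mem_cylinder_iff, FullShift.length_take, FullShift.take_eq_take]

theorem self_mem_cylinder_take (x : FullShift K) (n : ℕ) : x ∈ cylinder (x.take n) :=
  mem_cylinder_take.2 fun _ _ => rfl

theorem mem_prefixes {Z : Set (FullShift K)} {W : List (Fin K)} :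
    W ∈ prefixes Z W.length ↔ (cylinder W ∩ Z).Nonempty := by
  constructor
  · rintro ⟨x, hx, h⟩
    exact ⟨x, mem_cylinder_iff.2 h, hx⟩
  · rintro ⟨x, h, hx⟩
    exact ⟨x, hx, mem_cylinder_iff.1 h⟩

theorem length_of_mem_prefixes {Z : Set (FullShift K)} {n : ℕ} {W : List (Fin K)}
    (h : W ∈ prefixes Z n) : W.length = n := by
  obtain ⟨x, -, rfl⟩ := h
  simp

theorem finite_length_eq (n : ℕ) : {W : List (Fin K) | W.length = n}.Finite :=
  List.finite_length_eq (Fin K) n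

theorem finite_prefixes (Z : Set (FullShift K)) (n : ℕ) : (prefixes Z n).Finite :=
  (finite_length_eq n).subset fun _ h => length_of_mem_prefixes h

theorem FullShift.dist_def (x y : FullShift K) : dist x y = FullShift.rho x y := rfl

theorem FullShift.card_pos (x : FullShift K) : (0 : ℝ) < K :=
  zero_lt_one.trans_le x.one_le_card

theorem FullShift.dist_le_of_agree {x y : FullShift K} {n : ℕ} (h : ∀ i < n, x i = y i) :
    dist x y ≤ ((K : ℝ) ^ n)⁻¹ := by
  have hK := x.one_le_card
  by_cases hxy : x = y
  · subst hxy
    rw [dist_self]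
    positivity
  · have hn : n ≤ PiNat.firstDiff (E := fun _ => Fin K) x y :=
      (PiNat.mem_cylinder_iff_le_firstDiff (E := fun _ => Fin K) hxy n).1 h
    rw [FullShift.dist_def, FullShift.rho, if_neg hxy]
    have := x.card_pos
    gcongr

theorem FullShift.le_dist_of_ne {x y : FullShift K} {n : ℕ} (h : x n ≠ y n) :
    ((K : ℝ) ^ n)⁻¹ ≤ dist x y := by
  have hK := x.one_le_card
  have := x.card_pos
  have hxy : x ≠ y := fun e => h (by rw [e])
  have hn : PiNat.firstDiff (E := fun _ => Fin K) x y ≤ n := by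
    by_contra! hlt
    exact h (PiNat.apply_eq_of_lt_firstDiff (E := fun _ => Fin K) hlt)
  rw [FullShift.dist_def, FullShift.rho, if_neg hxy]
  gcongr

theorem FullShift.dist_le_one (x y : FullShift K) : dist x y ≤ 1 := by
  simpa using FullShift.dist_le_of_agree (x := x) (y := y) (n := 0) (by simp)

theorem FullShift.agree_of_dist_lt {x y : FullShift K} {n : ℕ} (h : dist x y < ((K : ℝ) ^ n)⁻¹) :
    ∀ i < n + 1, x i = y i := by
  intro i hi
  by_contra hne
  have hK := x.one_le_card
  have := x.card_pos
  have h1 := FullShift.le_dist_of_ne hne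
  have h2 : ((K : ℝ) ^ n)⁻¹ ≤ ((K : ℝ) ^ i)⁻¹ := by
    gcongr
    omega
  linarith

/-- Points that agree long enough are close. For `K = 1` the bound `K ^ (-n)` does not tend to
`0`, but then there is at most one point. -/
theorem FullShift.exists_agree_dist_lt (K : ℕ) {ε : ℝ} (hε : 0 < ε) :
    ∃ n : ℕ, ∀ x y : FullShift K, (∀ i < n, x i = y i) → dist x y < ε := by
  rcases Nat.lt_or_ge 1 K with hK | hK
  · have hK' : (1 : ℝ) < K := by exact_mod_cast hK
    obtain ⟨n, hn⟩ := exists_pow_lt_of_lt_one hε (inv_lt_one_of_one_lt₀ hK')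
    refine ⟨n, fun x y h => (FullShift.dist_le_of_agree h).trans_lt ?_⟩
    rwa [← inv_pow]
  · refine ⟨0, fun x y _ => ?_⟩
    have : x = y := by
      funext i
      have h1 := (x i).2
      have h2 := (y i).2
      exact Fin.ext (by omega)
    rwa [this, dist_self]

theorem isOpen_cylinder (W : List (Fin K)) : IsOpen (cylinder W) := by
  rw [Metric.isOpen_iff]
  intro x hx
  refine ⟨((K : ℝ) ^ W.length)⁻¹, inv_pos.2 (pow_pos x.card_pos _), fun y hy => ?_⟩
  rw [mem_cylinder_iff] at hx ⊢
  rw [← hx, FullShift.length_take, FullShift.take_eq_take]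
  exact fun i hi => FullShift.agree_of_dist_lt (Metric.mem_ball.1 hy) i (by omega)

theorem exists_cylinder_subset {U : Set (FullShift K)} (hU : IsOpen U) {x : FullShift K}
    (hx : x ∈ U) : ∃ n, cylinder (x.take n) ⊆ U := by
  obtain ⟨ε, hε, h⟩ := Metric.isOpen_iff.1 hU x hx
  obtain ⟨n, hn⟩ := FullShift.exists_agree_dist_lt K hε
  exact ⟨n, fun y hy => h (hn y x (mem_cylinder_take.1 hy))⟩

theorem mem_closure_iff_cylinder {Z : Set (FullShift K)} {x : FullShift K} :
    x ∈ closure Z ↔ ∀ n, ∃ y ∈ Z, ∀ i < n, y i = x i := by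
  rw [mem_closure_iff]
  constructor
  · intro h n
    obtain ⟨y, hy, hyZ⟩ := h _ (isOpen_cylinder (x.take n)) (self_mem_cylinder_take x n)
    exact ⟨y, hyZ, mem_cylinder_take.1 hy⟩
  · intro h U hU hx
    obtain ⟨n, hn⟩ := exists_cylinder_subset hU hx
    obtain ⟨y, hyZ, hy⟩ := h n
    exact ⟨y, hn (mem_cylinder_take.2 hy), hyZ⟩

/-- The metric of the full shift induces the product topology, hence a compact one. -/
instance FullShift.instCompactSpace (K : ℕ) : CompactSpace (FullShift K) := by
  let f : (ℕ → Fin K) → FullShift K := fun x => x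
  have hc : Continuous f := by
    refine continuous_def.2 fun U hU => isOpen_iff_mem_nhds.2 fun x hx => ?_
    obtain ⟨n, hn⟩ := exists_cylinder_subset (x := f x) hU hx
    have hopen : IsOpen (Set.pi (Finset.range n : Set ℕ) fun i : ℕ => ({x i} : Set (Fin K))) :=
      isOpen_set_pi (Finset.finite_toSet _) fun i _ => isOpen_discrete _
    refine mem_of_superset (hopen.mem_nhds fun i _ => rfl) fun y hy => hn ?_
    exact mem_cylinder_take.2 fun i hi => hy i (by simpa using hi)
  have hs : f.Surjective := fun x => ⟨x, rfl⟩
  exact hs.compactSpace hc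

theorem continuous_shift : Continuous (shift : FullShift K → FullShift K) := by
  refine Metric.continuous_iff.2 fun x ε hε => ?_
  obtain ⟨n, hn⟩ := FullShift.exists_agree_dist_lt K hε
  refine ⟨((K : ℝ) ^ n)⁻¹, inv_pos.2 (pow_pos x.card_pos _), fun y hy => hn _ _ fun i hi => ?_⟩
  exact FullShift.agree_of_dist_lt hy (i + 1) (by omega)

theorem shift_iterate_apply (n : ℕ) (x : FullShift K) (i : ℕ) : (shift^[n] x) i = x (n + i) := by
  induction n generalizing i with
  | zero => simp
  | succ n ih =>
    rw [Function.iterate_succ_apply']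
    change (shift^[n] x) (i + 1) = _
    rw [ih]
    congr 1
    omega

theorem isClosed_sft (A : Matrix (Fin K) (Fin K) ℕ) : IsClosed (sft A) := by
  refine isClosed_of_closure_subset fun x hx i => ?_
  obtain ⟨y, hy, h⟩ := mem_closure_iff_cylinder.1 hx (i + 2)
  rw [← h i (by omega), ← h (i + 1) (by omega)]
  exact hy i

theorem mapsTo_shift_iterate_sft (A : Matrix (Fin K) (Fin K) ℕ) (n : ℕ) {x : FullShift K}
    (hx : x ∈ sft A) : shift^[n] x ∈ sft A := by
  intro i
  rw [shift_iterate_apply, shift_iterate_apply, ← add_assoc]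
  exact hx (n + i)

/-! ### Mean distances -/

theorem continuous_orbitMean (ω : FullShift K) (n : ℕ) :
    Continuous fun y => orbitMean shift ω y n := by
  unfold orbitMean
  refine Continuous.div_const (continuous_finsetSum _ fun i _ => ?_) _
  exact continuous_const.dist (continuous_shift.iterate i)

theorem orbitMean_nonneg (ω y : FullShift K) (n : ℕ) : 0 ≤ orbitMean shift ω y n := by
  unfold orbitMean
  exact div_nonneg (Finset.sum_nonneg fun _ _ => dist_nonneg) n.cast_nonneg

theorem orbitMean_le_one (ω y : FullShift K) (n : ℕ) : orbitMean shift ω y n ≤ 1 := by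
  unfold orbitMean
  refine div_le_one_of_le₀ ?_ n.cast_nonneg
  simpa using Finset.sum_le_card_nsmul (Finset.range n)
    (fun i => dist (shift^[i] ω) (shift^[i] y)) 1 fun i _ => FullShift.dist_le_one _ _

theorem isBoundedUnder_le_orbitMean (ω y : FullShift K) :
    IsBoundedUnder (· ≤ ·) atTop (orbitMean shift ω y) :=
  isBoundedUnder_of ⟨1, orbitMean_le_one ω y⟩

theorem isBoundedUnder_ge_orbitMean (ω y : FullShift K) :
    IsBoundedUnder (· ≥ ·) atTop (orbitMean shift ω y) :=
  isBoundedUnder_of ⟨0, orbitMean_nonneg ω y⟩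

theorem isMeanLiYorkePair_of_frequently {ω y : FullShift K} {δ : ℝ} (hδ : 0 < δ)
    (h0 : ∀ ε > 0, ∃ᶠ n in atTop, orbitMean shift ω y n ≤ ε)
    (h1 : ∃ᶠ n in atTop, δ ≤ orbitMean shift ω y n) : IsMeanLiYorkePair shift ω y := by
  have hle := isBoundedUnder_le_orbitMean ω y
  have hge := isBoundedUnder_ge_orbitMean ω y
  refine ⟨le_antisymm ?_ ?_, hδ.trans_le (le_limsup_of_frequently_le h1 hle)⟩
  · refine le_of_forall_pos_le_add fun ε hε => ?_
    rw [zero_add]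
    exact liminf_le_of_frequently_le (h0 ε hε) hge
  · exact le_liminf_of_le hle.isCoboundedUnder_ge (Eventually.of_forall (orbitMean_nonneg ω y))

/-- The mean distance between `ω` and a point that eventually coincides with `ω` tends to `0`. -/
theorem tendsto_orbitMean_of_eventually_eq {ω y : FullShift K} {M : ℕ}
    (h : ∀ i ≥ M, y i = ω i) : Tendsto (orbitMean shift ω y) atTop (𝓝 0) := by
  have hsum : ∀ n, ∑ i ∈ Finset.range n, dist (shift^[i] ω) (shift^[i] y) ≤ M := by
    intro n
    calc ∑ i ∈ Finset.range n, dist (shift^[i] ω) (shift^[i] y)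
        ≤ ∑ i ∈ Finset.range n, if i < M then (1 : ℝ) else 0 := by
          refine Finset.sum_le_sum fun i _ => ?_
          split_ifs with hi
          · exact FullShift.dist_le_one _ _
          · refine le_of_eq (dist_eq_zero.2 (funext fun j => ?_))
            rw [shift_iterate_apply, shift_iterate_apply]
            exact (h _ (by omega)).symm
      _ ≤ M := by
          rw [Finset.sum_boole]
          have : (Finset.range n).filter (· < M) ⊆ Finset.range M := fun i hi => by
            simpa using (Finset.mem_filter.1 hi).2
          exact_mod_cast (Finset.card_le_card this).trans (by simp)
  refine squeeze_zero (orbitMean_nonneg ω y) (fun n => ?_)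
    (tendsto_const_div_atTop_nhds_zero_nat (M : ℝ))
  exact div_le_div_of_nonneg_right (hsum n) n.cast_nonneg

/-! ### Word sums controlled by counting words of each length -/

theorem wordSum_mono (s : ℝ≥0) {𝒱 𝒲 : Set (List (Fin K))} (h : 𝒱 ⊆ 𝒲) :
    wordSum s 𝒱 ≤ wordSum s 𝒲 :=
  ENNReal.tsum_mono_subtype
    (fun W : List (Fin K) => ENNReal.ofReal (Real.exp (-((s : ℝ) * W.length)))) h

theorem wordSum_of_length_eq (s : ℝ≥0) {n : ℕ} {𝒲 : Set (List (Fin K))}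
    (h : ∀ W ∈ 𝒲, W.length = n) :
    wordSum s 𝒲 = ENNReal.ofReal (𝒲.ncard * Real.exp (-((s : ℝ) * n))) := by
  have hfin : 𝒲.Finite := (finite_length_eq n).subset h
  have : wordSum s 𝒲 = ∑' _ : 𝒲, ENNReal.ofReal (Real.exp (-((s : ℝ) * n))) :=
    tsum_congr fun W => by rw [h W W.2]
  rw [this, ENNReal.tsum_const, ENNReal.ofReal_mul (Nat.cast_nonneg _), ENNReal.ofReal_natCast]
  congr 1
  change ((𝒲.encard : ℕ∞) : ℝ≥0∞) = _
  rw [← hfin.cast_ncard_eq]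
  simp

/-- If words are counted at exponential rate at most `s`, then for `s < s'` the sums
`∑ e^{-s'|W|}` over the words of length at least `M` tend to `0`, uniformly, as `M → ∞`. -/
theorem exists_wordSum_le {s s' : ℝ≥0} (h : s < s') :
    ∃ g : ℕ → ℝ≥0∞, Tendsto g atTop (𝓝 0) ∧ ∀ (M : ℕ) (𝒲 : Set (List (Fin K))),
      (∀ W ∈ 𝒲, M ≤ W.length) →
      (∀ n ≥ M, ((𝒲 ∩ {W | W.length = n}).ncard : ℝ) ≤ Real.exp (s * n)) →
      wordSum s' 𝒲 ≤ g M := by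
  have hss : (s : ℝ) < s' := h
  set r : ℝ≥0∞ := ENNReal.ofReal (Real.exp (-(s' - s : ℝ))) with hr
  have hr1 : r < 1 := by
    rw [hr, ENNReal.ofReal_lt_one, Real.exp_lt_one_iff]
    linarith
  refine ⟨fun M => ∑' k : ℕ, r ^ (k + M), ENNReal.tendsto_sum_nat_add _ ?_, ?_⟩
  · rw [ENNReal.tsum_geometric]
    exact ENNReal.inv_ne_top.2 (tsub_pos_of_lt hr1).ne'
  · intro M 𝒲 hM hcount
    have hU : 𝒲 ⊆ ⋃ k : ℕ, 𝒲 ∩ {W | W.length = k + M} := fun W hW =>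
      mem_iUnion.2 ⟨W.length - M, hW, by have := hM W hW; simp; omega⟩
    refine (wordSum_mono s' hU).trans ((ENNReal.tsum_iUnion_le_tsum
      (fun W : List (Fin K) => ENNReal.ofReal (Real.exp (-((s' : ℝ) * W.length)))) _).trans ?_)
    refine ENNReal.tsum_le_tsum fun k => ?_
    refine (wordSum_of_length_eq s' (n := k + M) fun W hW => hW.2).trans_le ?_
    rw [hr, ← ENNReal.ofReal_pow (Real.exp_pos _).le]
    refine ENNReal.ofReal_le_ofReal ?_
    calc _ ≤ Real.exp (s * (k + M : ℕ)) * Real.exp (-(s' * (k + M : ℕ))) := by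
          gcongr
          exact hcount _ (by omega)
      _ = _ := by
          rw [← Real.exp_add, ← Real.exp_nat_mul]
          ring_nf

theorem iInf_coe_le_of_forall_gt {p : ℝ≥0 → Prop} {s : ℝ≥0} (h : ∀ s' > s, p s') :
    ⨅ (t : ℝ≥0) (_ : p t), (t : ℝ≥0∞) ≤ s := by
  refine le_of_forall_gt_imp_ge_of_dense fun c hc => ?_
  obtain ⟨t, h1, h2⟩ := ENNReal.lt_iff_exists_nnreal_btwn.1 hc
  exact (iInf₂_le t (h t (by exact_mod_cast h1))).trans h2.le

/-! ### Upper bounds for the two entropies -/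

theorem packingPre_mono (s : ℝ≥0) (N : ℕ) {Y Z : Set (FullShift K)} (h : Y ⊆ Z) :
    packingPre s N Y ≤ packingPre s N Z :=
  iSup_mono fun _ => iSup_mono' fun hY =>
    ⟨fun W hW => ⟨(hY W hW).1, (hY W hW).2.1, (hY W hW).2.2.mono (by gcongr)⟩, le_rfl⟩

theorem packingMeasure_mono (s : ℝ≥0) {Y Z : Set (FullShift K)} (h : Y ⊆ Z) :
    packingMeasure s Y ≤ packingMeasure s Z :=
  iInf_mono fun _ => iInf_mono' fun hZ => ⟨h.trans hZ, le_rfl⟩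

theorem packingEntropy_mono {Y Z : Set (FullShift K)} (h : Y ⊆ Z) :
    packingEntropy Y ≤ packingEntropy Z :=
  iInf_mono fun _ => iInf_mono' fun hZ =>
    ⟨le_antisymm ((packingMeasure_mono _ h).trans_eq hZ) zero_le, le_rfl⟩

theorem packingPreLim_empty (s : ℝ≥0) : packingPreLim s (∅ : Set (FullShift K)) = 0 := by
  refine le_antisymm (iInf_le_of_le 0 (iSup₂_le fun 𝒲 h𝒲 => iSup_le fun _ => ?_)) zero_le
  have : 𝒲 = ∅ := by
    refine eq_empty_of_forall_notMem fun W hW => ?_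
    simpa using (h𝒲 W hW).2.2
  subst this
  simp [wordSum]

theorem packingMeasure_le_packingPreLim (s : ℝ≥0) (Z : Set (FullShift K)) :
    packingMeasure s Z ≤ packingPreLim s Z := by
  refine iInf₂_le_of_le (fun i => if i = 0 then Z else ∅)
    (fun x hx => mem_iUnion.2 ⟨0, by simpa using hx⟩) ?_
  rw [tsum_eq_single 0]
  · simp
  · intro i hi
    simp [hi, packingPreLim_empty]

theorem packingEntropy_le_of_growth {Z : Set (FullShift K)} {s : ℝ≥0}
    (h : ∀ᶠ n in atTop, ((prefixes Z n).ncard : ℝ) ≤ Real.exp (s * n)) :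
    packingEntropy Z ≤ s := by
  refine iInf_coe_le_of_forall_gt fun s' hs => ?_
  obtain ⟨g, hg, hle⟩ := exists_wordSum_le (K := K) hs
  obtain ⟨M₀, hM₀⟩ := eventually_atTop.1 h
  refine le_antisymm ((packingMeasure_le_packingPreLim s' Z).trans ?_) zero_le
  refine ge_of_tendsto hg (eventually_atTop.2 ⟨M₀, fun M hM => ?_⟩)
  refine iInf_le_of_le M (iSup₂_le fun 𝒲 h𝒲 => iSup_le fun _ => ?_)
  refine hle M 𝒲 (fun W hW => (h𝒲 W hW).2.1) fun n hn => le_trans ?_ (hM₀ n (by omega))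
  refine Nat.cast_le.2 (ncard_le_ncard ?_ (finite_prefixes Z n))
  rintro W ⟨hW, rfl⟩
  exact mem_prefixes.2 (h𝒲 W hW).2.2

/-- A set of points that all have infinitely many prefixes in a family of words of exponential
growth rate at most `s` has Bowen entropy at most `s`. -/
theorem bowenEntropy_le_of_frequently {Z : Set (FullShift K)} {s : ℝ≥0} {B : Set (List (Fin K))}
    (hB : ∀ᶠ n in atTop, ((B ∩ {W | W.length = n}).ncard : ℝ) ≤ Real.exp (s * n))
    (hZ : ∀ x ∈ Z, ∃ᶠ n in atTop, x.take n ∈ B) :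
    bowenEntropy Z ≤ s := by
  refine iInf_coe_le_of_forall_gt fun s' hs => ?_
  obtain ⟨g, hg, hle⟩ := exists_wordSum_le (K := K) hs
  obtain ⟨M₀, hM₀⟩ := eventually_atTop.1 hB
  refine le_antisymm (iSup_le fun N => ?_) zero_le
  refine ge_of_tendsto hg (eventually_atTop.2 ⟨max M₀ (N + 1), fun M hM => ?_⟩)
  have hM1 : M₀ ≤ M := (le_max_left _ _).trans hM
  have hM2 : N + 1 ≤ M := (le_max_right _ _).trans hM
  refine iInf_le_of_le (B ∩ {W | M ≤ W.length}) (iInf₂_le_of_le ?_ ?_ ?_)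
  · exact fun W hW => lt_of_lt_of_le hM2 hW.2
  · intro x hx
    obtain ⟨n, hn, hxn⟩ := frequently_atTop.1 (hZ x hx) M
    exact mem_iUnion₂.2 ⟨_, ⟨hxn, by simpa using hn⟩, self_mem_cylinder_take x n⟩
  · refine hle M _ (fun W hW => hW.2) fun n hn => le_trans ?_ (hM₀ n (by omega))
    refine Nat.cast_le.2 (ncard_le_ncard ?_ ((finite_length_eq n).subset fun W hW => hW.2))
    exact fun W hW => ⟨hW.1.1, hW.2⟩

theorem bowenEntropy_le_of_growth {Z : Set (FullShift K)} {s : ℝ≥0}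
    (h : ∀ᶠ n in atTop, ((prefixes Z n).ncard : ℝ) ≤ Real.exp (s * n)) :
    bowenEntropy Z ≤ s := by
  refine bowenEntropy_le_of_frequently (B := ⋃ n, prefixes Z n) ?_ fun x hx =>
    Frequently.of_forall fun n => mem_iUnion.2 ⟨n, x, hx, rfl⟩
  filter_upwards [h] with n hn
  refine le_trans (Nat.cast_le.2 (ncard_le_ncard ?_ (finite_prefixes Z n))) hn
  rintro W ⟨hW, rfl⟩
  obtain ⟨m, hm⟩ := mem_iUnion.1 hW
  rwa [length_of_mem_prefixes hm]

/-! ### Words close to the prefixes of a fixed point -/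

/-- The words that begin a point at mean distance at most `ε` from `ω` up to the length of
the word. -/
def nearWords (ω : FullShift K) (ε : ℝ) : Set (List (Fin K)) :=
  {W | ∃ y : FullShift K, y.take W.length = W ∧ orbitMean shift ω y W.length ≤ ε}

/-- For small `ε` the words near `ω` have small exponential growth rate. This is the Chernoff
bound: weighting a word by `e^{aε - a}` at each position where it differs from `ω` and by
`e^{aε}` elsewhere gives every near word weight at least `1`, while the weights of all words of
length `n` add up to `(e^{aε} (1 + (K - 1) e^{-a}))^n`. -/
theorem exists_ncard_nearWords_le (ω : FullShift K) {s : ℝ} (hs : 0 < s) :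
    ∃ ε > 0, ∀ n : ℕ,
      ((nearWords ω ε ∩ {W | W.length = n}).ncard : ℝ) ≤ Real.exp (s * n) := by
  have hK := ω.card_pos
  -- With this `a`, and `ε = s / (2a)` below, both `K e^{-a}` and `aε` are at most `s / 2`.
  set a : ℝ := 2 * K / s with ha
  have ha0 : 0 < a := by positivity
  have haK : K * Real.exp (-a) ≤ s / 2 := by
    have h1 : a ≤ Real.exp a := by linarith [Real.add_one_le_exp a]
    have h2 : Real.exp (-a) ≤ a⁻¹ := by
      rw [Real.exp_neg]
      gcongr
    calc K * Real.exp (-a) ≤ K * a⁻¹ := by gcongr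
      _ = s / 2 := by
        rw [ha]
        field_simp
  refine ⟨s / (2 * a), by positivity, fun n => ?_⟩
  set ε := s / (2 * a) with hε
  have haε : a * ε = s / 2 := by
    rw [hε]
    field_simp
  let ind : Fin n → Fin K → ℝ := fun i b => if b = ω i then 0 else 1
  let S : Finset (Fin n → Fin K) := Finset.univ.filter fun v => ∑ i, ind i (v i) ≤ ε * n
  have hsub : nearWords ω ε ∩ {W | W.length = n} ⊆ List.ofFn '' (S : Set (Fin n → Fin K)) := by
    rintro W ⟨⟨y, hyW, hy⟩, rfl⟩
    refine ⟨fun i => y i, ?_, hyW⟩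
    simp only [S, Finset.coe_filter, Finset.mem_univ, true_and, mem_ofPred_eq]
    rcases Nat.eq_zero_or_pos W.length with h0 | hpos
    · have : IsEmpty (Fin W.length) := by
        rw [h0]
        infer_instance
      simp [h0]
    have hpos' : (0 : ℝ) < W.length := by exact_mod_cast hpos
    rw [orbitMean, div_le_iff₀ hpos'] at hy
    refine le_trans ?_ hy
    rw [← Fin.sum_univ_eq_sum_range (fun i => dist (shift^[i] ω) (shift^[i] y))]
    refine Finset.sum_le_sum fun i _ => ?_
    simp only [ind]
    split_ifs with h
    · exact dist_nonneg
    · have : (shift^[(i : ℕ)] ω) 0 ≠ (shift^[(i : ℕ)] y) 0 := by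
        rw [shift_iterate_apply, shift_iterate_apply]
        exact fun e => h e.symm
      simpa using FullShift.le_dist_of_ne this
  have hcard : ((nearWords ω ε ∩ {W | W.length = n}).ncard : ℝ) ≤ S.card := by
    refine Nat.cast_le.2 ((ncard_le_ncard hsub ((Finset.finite_toSet S).image _)).trans ?_)
    exact (ncard_image_le (Finset.finite_toSet S)).trans_eq (ncard_coe_finset S)
  refine hcard.trans ?_
  calc (S.card : ℝ) = ∑ v ∈ S, (1 : ℝ) := by simp
    _ ≤ ∑ v ∈ S, ∏ i, Real.exp (a * ε - a * ind i (v i)) := by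
        refine Finset.sum_le_sum fun v hv => ?_
        rw [← Real.exp_sum, Real.one_le_exp_iff, Finset.sum_sub_distrib]
        have : ∑ i, ind i (v i) ≤ ε * n := (Finset.mem_filter.1 hv).2
        simp only [Finset.sum_const, Finset.card_univ, Fintype.card_fin, nsmul_eq_mul]
        rw [← Finset.mul_sum]
        linarith [mul_le_mul_of_nonneg_left this ha0.le]
    _ ≤ ∑ v : Fin n → Fin K, ∏ i, Real.exp (a * ε - a * ind i (v i)) :=
        Finset.sum_le_sum_of_subset_of_nonneg (Finset.subset_univ _) fun v _ _ => by positivity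
    _ = ∏ i : Fin n, ∑ b : Fin K, Real.exp (a * ε - a * ind i b) := by
        rw [Finset.prod_univ_sum, Fintype.piFinset_univ]
    _ ≤ ∏ _i : Fin n, Real.exp s := by
        refine Finset.prod_le_prod (fun i _ => by positivity) fun i _ => ?_
        calc ∑ b : Fin K, Real.exp (a * ε - a * ind i b)
            ≤ ∑ b : Fin K, (Real.exp (a * ε) * Real.exp (-a)
                + if b = ω i then Real.exp (a * ε) else 0) := by
              refine Finset.sum_le_sum fun b _ => ?_
              simp only [ind]
              split_ifs with h
              · simp only [mul_zero, sub_zero, le_add_iff_nonneg_left]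
                positivity
              · rw [← Real.exp_add]
                simp [sub_eq_add_neg]
          _ = Real.exp (a * ε) * (K * Real.exp (-a) + 1) := by
              rw [Finset.sum_add_distrib]
              simp
              ring
          _ ≤ Real.exp (a * ε) * Real.exp (K * Real.exp (-a)) := by
              gcongr
              exact Real.add_one_le_exp _
          _ ≤ Real.exp s := by
              rw [← Real.exp_add, Real.exp_le_exp]
              linarith
    _ = Real.exp (s * n) := by
        rw [Finset.prod_const, Finset.card_univ, Fintype.card_fin, ← Real.exp_nat_mul, mul_comm]

/-- A point whose lower mean distance to `ω` vanishes agrees with `ω` most of the time up to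
infinitely many times, so the mean Li-Yorke set has Bowen entropy `0`. -/
theorem bowenEntropy_meanLiYorkeSet (A : Matrix (Fin K) (Fin K) ℕ) (ω : FullShift K) :
    bowenEntropy (meanLiYorkeSet A ω) = 0 := by
  refine le_antisymm (ENNReal.le_of_forall_pos_le_add fun s hs _ => ?_) zero_le
  rw [zero_add]
  obtain ⟨ε, hε, hle⟩ := exists_ncard_nearWords_le ω (s := s) hs
  refine bowenEntropy_le_of_frequently (B := nearWords ω ε) (Eventually.of_forall hle) ?_
  rintro y ⟨-, hy, -⟩
  have := frequently_lt_of_liminf_lt (isBoundedUnder_le_orbitMean ω y).isCoboundedUnder_ge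
    (hy.trans_lt hε)
  exact this.mono fun n hn => ⟨y, by simp, by simpa using hn.le⟩

/-! ### Paths in an irreducible shift of finite type -/

/-- The sequence that follows `x` before time `n` and continues with `y` from time `n` on. -/
def FullShift.splice (x : FullShift K) (n : ℕ) (y : FullShift K) : FullShift K :=
  fun i => if i < n then x i else y (i - n)

theorem FullShift.splice_of_lt (x y : FullShift K) {n i : ℕ} (h : i < n) :
    x.splice n y i = x i := if_pos h

@[simp] theorem FullShift.splice_add (x y : FullShift K) (n i : ℕ) :
    x.splice n y (n + i) = y i := by
  simp [FullShift.splice]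

theorem FullShift.splice_of_le {x y : FullShift K} {n i : ℕ} (hxy : x n = y 0) (h : i ≤ n) :
    x.splice n y i = x i := by
  rcases h.lt_or_eq with h | rfl
  · exact x.splice_of_lt y h
  · simpa [hxy] using x.splice_add y i 0

theorem splice_mem_sft {A : Matrix (Fin K) (Fin K) ℕ} {x y : FullShift K} {n : ℕ}
    (hx : x ∈ sft A) (hy : y ∈ sft A) (hxy : x n = y 0) : x.splice n y ∈ sft A := by
  intro i
  rcases Nat.lt_or_ge i n with h | h
  · rw [FullShift.splice_of_le hxy h.le, FullShift.splice_of_le hxy (Nat.succ_le_of_lt h)]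
    exact hx i
  · obtain ⟨j, rfl⟩ := Nat.exists_eq_add_of_le h
    rw [add_assoc, FullShift.splice_add, FullShift.splice_add]
    exact hy j

theorem exists_mem_sft_of_pow_pos {A : Matrix (Fin K) (Fin K) ℕ}
    (hA : ∀ i j, A i j = 0 ∨ A i j = 1) {y : FullShift K} (hy : y ∈ sft A) (r : ℕ) (a : Fin K)
    (h : 0 < (A ^ r) a (y 0)) : ∃ x ∈ sft A, x 0 = a ∧ ∀ i, x (r + i) = y i := by
  induction r generalizing a with
  | zero =>
    have : a = y 0 := by
      by_contra hne
      simp [Matrix.one_apply_ne hne] at h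
    exact ⟨y, hy, this.symm, fun i => by rw [zero_add]⟩
  | succ r ih =>
    rw [pow_succ', Matrix.mul_apply] at h
    obtain ⟨c, -, hc⟩ := Finset.exists_ne_zero_of_sum_ne_zero h.ne'
    obtain ⟨h1, h2⟩ := mul_ne_zero_iff.1 hc
    obtain ⟨x, hx, hx0, hxr⟩ := ih c (Nat.pos_of_ne_zero h2)
    refine ⟨fun i => Nat.casesOn i a x, ?_, rfl, fun i => ?_⟩
    · intro i
      cases i with
      | zero =>
        change A a (x 0) = 1
        rw [hx0]
        exact (hA a c).resolve_left h1
      | succ i => exact hx i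
    · rw [add_right_comm]
      exact hxr i

/-- In an irreducible shift of finite type every point can be reached from every symbol, after
a positive time that depends only on the two end symbols. -/
theorem exists_connecting {A : Matrix (Fin K) (Fin K) ℕ} (hA : ∀ i j, A i j = 0 ∨ A i j = 1)
    (hirr : ∀ i j, ∃ r : ℕ, 0 < r ∧ 0 < (A ^ r) i j) :
    ∃ R : Fin K → Fin K → ℕ, (∀ a b, 0 < R a b) ∧ ∀ (a : Fin K), ∀ y ∈ sft A,
      ∃ x ∈ sft A, x 0 = a ∧ ∀ i, x (R a (y 0) + i) = y i := by
  choose R hR hpow using hirr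
  exact ⟨R, hR, fun a y hy => exists_mem_sft_of_pow_pos hA hy _ a (hpow a (y 0))⟩

/-- The points of `Σ_A` that coincide with `ω` from some time on. -/
def tailSet (A : Matrix (Fin K) (Fin K) ℕ) (ω : FullShift K) : Set (FullShift K) :=
  {y | y ∈ sft A ∧ ∃ M, ∀ i ≥ M, y i = ω i}

/-- Repeating a closed loop of length `ℓ` before joining a given continuation. -/
theorem exists_repeat_loop {A : Matrix (Fin K) (Fin K) ℕ} {p u : FullShift K} (hp : p ∈ sft A)
    (hu : u ∈ sft A) {ℓ : ℕ} (hloop : p ℓ = p 0) (hpu : p 0 = u 0) (j : ℕ) :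
    ∃ q ∈ sft A, q 0 = p 0 ∧ (0 < j → ∀ i < ℓ, q i = p i) ∧ ∀ i, q (j * ℓ + i) = u i := by
  induction j with
  | zero => exact ⟨u, hu, hpu.symm, fun h => absurd h (lt_irrefl _), fun i => by simp⟩
  | succ j ih =>
    obtain ⟨q, hq, hq0, -, hqu⟩ := ih
    have hpq : p ℓ = q 0 := hloop.trans hq0.symm
    refine ⟨p.splice ℓ q, splice_mem_sft hp hq hpq,
      FullShift.splice_of_le hpq (Nat.zero_le _), fun _ i hi => p.splice_of_lt q hi, fun i => ?_⟩
    rw [show (j + 1) * ℓ + i = ℓ + (j * ℓ + i) by ring, FullShift.splice_add, hqu]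

/-- A point that meets `ω` at some time can be modified after any prescribed time so as to
coincide with `ω` eventually. No aperiodicity is needed: a return to the meeting symbol `c`
closes a loop of some length `ℓ`, and along the times `m + kℓ` the sequence `ω` visits some
symbol twice, say for `k < k'`. Running through the loop `k' - k` times and then along `ω` for
time `kℓ` leads to that symbol exactly at the time `m + k'ℓ`, when `ω` is there. -/
theorem exists_tailSet_agree {A : Matrix (Fin K) (Fin K) ℕ} (hA : ∀ i j, A i j = 0 ∨ A i j = 1)
    (hirr : ∀ i j, ∃ r : ℕ, 0 < r ∧ 0 < (A ^ r) i j) {ω x : FullShift K} (hω : ω ∈ sft A)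
    (hx : x ∈ sft A) {m n : ℕ} (hm : x m = ω m) (hmn : m ≤ n) :
    ∃ y ∈ tailSet A ω, ∀ i < n, y i = x i := by
  obtain ⟨R, hR, hconn⟩ := exists_connecting hA hirr
  have hωm := mapsTo_shift_iterate_sft A m hω
  obtain ⟨v, hv, hv0, hvr⟩ := hconn (x n) _ hωm
  set r := R (x n) ((shift^[m] ω) 0) with hr
  have hrpos : 0 < r := hR _ _
  have hvR : v r = ω m := by
    have := hvr 0
    rwa [shift_iterate_apply, add_zero, add_zero] at this
  have hxv : (x.splice n v) ∈ sft A := splice_mem_sft hx hv hv0.symm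
  obtain ⟨d, rfl⟩ := Nat.exists_eq_add_of_le hmn
  set p := shift^[m] (x.splice (m + d) v) with hp
  have hpA : p ∈ sft A := mapsTo_shift_iterate_sft A m hxv
  have hp_lt : ∀ i ≤ d, p i = x (m + i) := fun i hi => by
    rw [hp, shift_iterate_apply, FullShift.splice_of_le hv0.symm (by omega)]
  have hp0 : p 0 = ω m := by rw [hp_lt 0 (Nat.zero_le _), add_zero, hm]
  have hpℓ : p (d + r) = p 0 := by
    rw [hp0, hp, shift_iterate_apply, ← add_assoc, FullShift.splice_add, hvR]
  set ℓ := d + r with hℓ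
  obtain ⟨k, k', hkk, heq⟩ : ∃ k k', k < k' ∧ ω (m + k * ℓ) = ω (m + k' * ℓ) := by
    obtain ⟨k, k', hne, he⟩ :=
      Finite.exists_ne_map_eq_of_infinite fun k : ℕ => ω (m + k * ℓ)
    rcases hne.lt_or_gt with h | h
    · exact ⟨k, k', h, he⟩
    · exact ⟨k', k, h, he.symm⟩
  obtain ⟨q, hq, hq0, hqp, hqu⟩ := exists_repeat_loop hpA hωm hpℓ
    (by rw [hp0, shift_iterate_apply, add_zero]) (k' - k)
  have hqk : q (k' * ℓ) = (shift^[m + k' * ℓ] ω) 0 := by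
    have := hqu (k * ℓ)
    rw [← add_mul, Nat.sub_add_cancel hkk.le, shift_iterate_apply] at this
    rw [this, heq, shift_iterate_apply, add_zero]
  have hz := splice_mem_sft hq (mapsTo_shift_iterate_sft A (m + k' * ℓ) hω) hqk
  set z := q.splice (k' * ℓ) (shift^[m + k' * ℓ] ω) with hzdef
  have hk'ℓ : ℓ ≤ k' * ℓ := Nat.le_mul_of_pos_left _ (by omega)
  have hz_lt : ∀ i ≤ d, z i = x (m + i) := fun i hi => by
    rw [hzdef, FullShift.splice_of_lt _ _ (by omega), hqp (by omega) i (by omega),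
      hp_lt i hi]
  have hxz : x m = z 0 := by rw [hz_lt 0 (Nat.zero_le _), add_zero]
  refine ⟨x.splice m z, ⟨splice_mem_sft hx hz hxz, m + k' * ℓ, fun i hi => ?_⟩, fun i hi => ?_⟩
  · obtain ⟨j, rfl⟩ := Nat.exists_eq_add_of_le hi
    rw [add_assoc, FullShift.splice_add, hzdef, FullShift.splice_add, shift_iterate_apply]
    congr 1
    omega
  · rcases Nat.lt_or_ge i m with h | h
    · exact x.splice_of_lt z h
    · obtain ⟨j, rfl⟩ := Nat.exists_eq_add_of_le h
      rw [FullShift.splice_add, hz_lt j (by omega)]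

theorem mem_closure_tailSet {A : Matrix (Fin K) (Fin K) ℕ} (hA : ∀ i j, A i j = 0 ∨ A i j = 1)
    (hirr : ∀ i j, ∃ r : ℕ, 0 < r ∧ 0 < (A ^ r) i j) {ω x : FullShift K} (hω : ω ∈ sft A)
    (hx : x ∈ sft A) {m : ℕ} (hm : x m = ω m) : x ∈ closure (tailSet A ω) := by
  refine mem_closure_iff_cylinder.2 fun n => ?_
  obtain ⟨y, hy, hyx⟩ := exists_tailSet_agree hA hirr hω hx hm (le_max_left m n)
  exact ⟨y, hy, fun i hi => hyx i (hi.trans_le (le_max_right _ _))⟩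

theorem closure_tailSet_subset (A : Matrix (Fin K) (Fin K) ℕ) (ω : FullShift K) :
    closure (tailSet A ω) ⊆ sft A :=
  closure_minimal (fun _ h => h.1) (isClosed_sft A)

/-- Some symbol starts at least the average number of words. -/
theorem exists_symbol_ncard_prefixes (A : Matrix (Fin K) (Fin K) ℕ) (hK : 0 < K) (n : ℕ) :
    ∃ a : Fin K, ((prefixes (sft A) n).ncard : ℝ) ≤
      K * (prefixes (sft A ∩ {x | x 0 = a}) n).ncard := by
  have hsub : prefixes (sft A) n ⊆ ⋃ a : Fin K, prefixes (sft A ∩ {x | x 0 = a}) n := by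
    rintro W ⟨x, hx, rfl⟩
    exact mem_iUnion.2 ⟨x 0, x, ⟨hx, rfl⟩, rfl⟩
  have hne : (Finset.univ : Finset (Fin K)).Nonempty := ⟨⟨0, hK⟩, Finset.mem_univ _⟩
  obtain ⟨a, -, ha⟩ := Finset.exists_max_image Finset.univ
    (fun a : Fin K => (prefixes (sft A ∩ {x | x 0 = a}) n).ncard) hne
  refine ⟨a, ?_⟩
  have h1 : (prefixes (sft A) n).ncard ≤
      ∑ b : Fin K, (prefixes (sft A ∩ {x | x 0 = b}) n).ncard :=
    (ncard_le_ncard hsub (finite_iUnion fun _ => finite_prefixes _ n)).trans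
      (ncard_iUnion_le_of_fintype _)
  have h2 := h1.trans (Finset.sum_le_card_nsmul _ _ _ fun b hb => ha b hb)
  simp only [Finset.card_univ, Fintype.card_fin, smul_eq_mul] at h2
  exact_mod_cast h2

/-- Every cylinder that meets the closure `E` of the points eventually equal to `ω` captures
the whole exponential growth of the words of `Σ_A`. -/
theorem frequently_exp_le_ncard_prefixes {A : Matrix (Fin K) (Fin K) ℕ}
    (hA : ∀ i j, A i j = 0 ∨ A i j = 1) (hirr : ∀ i j, ∃ r : ℕ, 0 < r ∧ 0 < (A ^ r) i j)
    {ω : FullShift K} (hω : ω ∈ sft A) {s s' : ℝ} (hss : s < s')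
    (hgrowth : ∃ᶠ n : ℕ in atTop, Real.exp (s' * n) ≤ (prefixes (sft A) n).ncard)
    {W : List (Fin K)} (hW : (cylinder W ∩ closure (tailSet A ω)).Nonempty) :
    ∃ᶠ n : ℕ in atTop,
      Real.exp (s * n) ≤ (prefixes (cylinder W ∩ closure (tailSet A ω)) n).ncard := by
  obtain ⟨R, hR, hconn⟩ := exists_connecting hA hirr
  obtain ⟨y, hyW, hyA, M, hM⟩ :=
    (closure_inter_open_nonempty_iff (isOpen_cylinder W)).1 (by rwa [inter_comm]) |>.imp
      fun _ h => h.symm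
  have hKpos : 0 < K := (ω 0).pos
  have hK : (0 : ℝ) < K := ω.card_pos
  set m := max M W.length with hm
  have hym : y m = ω m := hM m (le_max_left _ _)
  set D : ℕ := ∑ a, R (y m) a with hD
  -- The bounded transition time to the best initial symbol costs only a constant factor.
  have hlarge : ∀ᶠ n : ℕ in atTop, ∀ r ≤ D, Real.exp (s * (m + r + n : ℕ)) * K ≤
      Real.exp (s' * n) := by
    have ht : Tendsto (fun n : ℕ => (s' - s) * (n : ℝ)) atTop atTop :=
      tendsto_natCast_atTop_atTop.const_mul_atTop (by linarith)
    filter_upwards [ht.eventually_ge_atTop (|s| * (m + D) + Real.log K)] with n hn r hr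
    calc Real.exp (s * (m + r + n : ℕ)) * K
        = Real.exp (s * (m + r + n : ℕ) + Real.log K) := by rw [Real.exp_add, Real.exp_log hK]
      _ ≤ _ := Real.exp_le_exp.2 ?_
    push_cast
    have h1 : s * (m + r) ≤ |s| * (m + D) := by
      have : (r : ℝ) ≤ D := by exact_mod_cast hr
      calc s * (m + r) ≤ |s| * (m + r) := by
            gcongr
            exact le_abs_self s
        _ ≤ _ := by gcongr
    linarith
  refine frequently_atTop.2 fun N => ?_
  obtain ⟨n, ⟨hn, hn1⟩, hn2⟩ :=
    ((hgrowth.and_eventually hlarge).and_eventually (eventually_ge_atTop N)).exists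
  obtain ⟨a, ha⟩ := exists_symbol_ncard_prefixes A hKpos n
  rcases (prefixes (sft A ∩ {x | x 0 = a}) n).eq_empty_or_nonempty with h0 | ⟨_, z₀, hz₀, -⟩
  · rw [h0, ncard_empty] at ha
    have := Real.exp_pos (s' * n)
    rw [Nat.cast_zero, mul_zero] at ha
    linarith
  obtain ⟨u, hu, hu0, hur⟩ := hconn (y m) z₀ hz₀.1
  have hz₀a : z₀ 0 = a := hz₀.2
  rw [hz₀a] at hur
  set r := R (y m) a with hr
  have hrD : r ≤ D := Finset.single_le_sum (f := fun a => R (y m) a)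
    (fun _ _ => Nat.zero_le _) (Finset.mem_univ a)
  have hura : u r = a := by
    have := hur 0
    rwa [add_zero, hz₀a] at this
  refine ⟨m + r + n, by omega, ?_⟩
  have hle : (prefixes (sft A ∩ {x | x 0 = a}) n).ncard ≤
      (prefixes (cylinder W ∩ closure (tailSet A ω)) (m + r + n)).ncard := by
    refine ncard_le_ncard_of_injOn (fun V => y.take m ++ (u.take r ++ V)) ?_ ?_
      (finite_prefixes _ _)
    · rintro _ ⟨z, ⟨hz, hza⟩, rfl⟩
      have huz : u r = z 0 := hura.trans hza.symm
      have h1 := splice_mem_sft hu hz huz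
      have hyu : y m = (u.splice r z) 0 := by
        rw [FullShift.splice_of_le huz (Nat.zero_le _), hu0]
      have h2 := splice_mem_sft hyA h1 hyu
      refine ⟨y.splice m (u.splice r z), ⟨?_, mem_closure_tailSet hA hirr hω h2 (m := m) ?_⟩, ?_⟩
      · rw [mem_cylinder_iff] at hyW ⊢
        refine Eq.trans (FullShift.take_eq_take.2 fun i hi => ?_) hyW
        exact y.splice_of_lt _ (hi.trans_le (le_max_right _ _))
      · rw [FullShift.splice_of_le hyu le_rfl, hym]
      · refine List.ext_getElem (by simp; omega) fun i h3 h4 => ?_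
        simp only [FullShift.take, List.getElem_append, List.getElem_ofFn, List.length_ofFn,
          FullShift.splice]
        split_ifs <;> rfl
    · intro V _ V' _ h
      exact List.append_cancel_left (List.append_cancel_left h)
  have h3 : Real.exp (s * (m + r + n : ℕ)) * K ≤
      K * (prefixes (cylinder W ∩ closure (tailSet A ω)) (m + r + n)).ncard :=
    calc _ ≤ Real.exp (s' * n) := hn1 r hrD
      _ ≤ _ := hn
      _ ≤ _ := ha
      _ ≤ _ := by gcongr
  rw [mul_comm] at h3
  exact le_of_mul_le_mul_left h3 hK

/-! ### Packing measures of residual sets -/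

/-- The packing premeasures do not distinguish a set from its closure: cylinders are open. -/
theorem packingPre_closure (s : ℝ≥0) (N : ℕ) (Z : Set (FullShift K)) :
    packingPre s N (closure Z) = packingPre s N Z := by
  refine le_antisymm (iSup_mono fun 𝒲 => iSup_mono' fun h => ⟨fun W hW => ?_, le_rfl⟩)
    (packingPre_mono s N subset_closure)
  obtain ⟨h1, h2, h3⟩ := h W hW
  refine ⟨h1, h2, ?_⟩
  rw [inter_comm] at h3 ⊢
  exact (closure_inter_open_nonempty_iff (isOpen_cylinder W)).1 h3

/-- A set containing a dense `G_δ` subset of a closed set `E` has infinite packing measure as soon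
as the packing premeasure of every nonempty relatively open piece of `E` is infinite: in any
countable cover of the set, some member is dense in such a piece, by the Baire theorem. -/
theorem packingMeasure_eq_top_of_residual {E Z : Set (FullShift K)}
    {O : ℕ → Set (FullShift K)} {s : ℝ≥0} (hE : IsClosed E) (hne : E.Nonempty)
    (hO : ∀ n, IsOpen (O n)) (hd : ∀ n, E ⊆ closure (E ∩ O n)) (hZ : E ∩ ⋂ n, O n ⊆ Z)
    (hs : ∀ W : List (Fin K), (cylinder W ∩ E).Nonempty →
      packingPreLim s (cylinder W ∩ E) = ⊤) :
    packingMeasure s Z = ⊤ := by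
  refine top_unique (le_iInf₂ fun C hC => ?_)
  have : CompactSpace E := isCompact_iff_compactSpace.1 hE.isCompact
  have : Nonempty E := hne.to_subtype
  let S : Set E := ⋂ n, (Subtype.val ⁻¹' O n : Set E)
  have hSO : ∀ n, IsOpen (Subtype.val ⁻¹' O n : Set E) := fun n =>
    (hO n).preimage continuous_subtype_val
  have hSd : Dense S := by
    refine dense_iInter_of_isOpen_nat hSO fun n x => ?_
    rw [closure_subtype, Subtype.image_preimage_coe]
    exact hd n x.2
  have hcov : S ⊆ ⋃ i, (Subtype.val ⁻¹' closure (C i) : Set E) := by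
    intro x hx
    have hxZ : (x : FullShift K) ∈ Z := hZ ⟨x.2, mem_iInter.2 fun n => mem_iInter.1 hx n⟩
    obtain ⟨i, hi⟩ := mem_iUnion.1 (hC hxZ)
    exact mem_iUnion.2 ⟨i, subset_closure hi⟩
  obtain ⟨x, hx⟩ := ((IsGδ.iInter_of_isOpen hSO).dense_iUnion_interior_of_closed hSd
    (fun i => isClosed_closure.preimage continuous_subtype_val) hcov).nonempty
  obtain ⟨i, hi⟩ := mem_iUnion.1 hx
  obtain ⟨U, hU, hUi⟩ := isOpen_induced_iff.1
    (isOpen_interior (s := (Subtype.val ⁻¹' closure (C i) : Set E)))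
  have hxU : (x : FullShift K) ∈ U := by
    rw [← hUi] at hi
    exact hi
  obtain ⟨n, hn⟩ := exists_cylinder_subset hU hxU
  have hsub : cylinder ((x : FullShift K).take n) ∩ E ⊆ closure (C i) := by
    rintro y ⟨hy, hyE⟩
    have : (⟨y, hyE⟩ : E) ∈ interior (Subtype.val ⁻¹' closure (C i) : Set E) := by
      rw [← hUi]
      exact hn hy
    exact interior_subset (s := (Subtype.val ⁻¹' closure (C i) : Set E)) this
  have htop := hs ((x : FullShift K).take n) ⟨x, self_mem_cylinder_take _ _, x.2⟩
  refine le_trans ?_ (ENNReal.le_tsum i)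
  rw [← htop]
  exact iInf_mono fun N => (packingPre_mono s N hsub).trans_eq (packingPre_closure s N _)

theorem packingPreLim_eq_top_of_growth {Z : Set (FullShift K)} {s : ℝ≥0} {t : ℝ} (hst : s < t)
    (h : ∃ᶠ n : ℕ in atTop, Real.exp (t * n) ≤ (prefixes Z n).ncard) :
    packingPreLim s Z = ⊤ := by
  refine iInf_eq_top.2 fun N => ENNReal.eq_top_of_forall_nnreal_le fun B => ?_
  have hlarge : ∀ᶠ n : ℕ in atTop, (B : ℝ) ≤ Real.exp ((t - s) * n) :=
    (Real.tendsto_exp_atTop.comp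
      (tendsto_natCast_atTop_atTop.const_mul_atTop (by linarith))).eventually_ge_atTop (B : ℝ)
  obtain ⟨n, ⟨hn, hB⟩, hN⟩ :=
    ((h.and_eventually hlarge).and_eventually (eventually_ge_atTop (N + 1))).exists
  have hlen : ∀ W ∈ prefixes Z n, W.length = n := fun W hW => length_of_mem_prefixes hW
  refine le_trans ?_ (le_iSup₂_of_le (prefixes Z n) ?_ (le_iSup_of_le ?_ le_rfl))
  · rw [wordSum_of_length_eq s hlen, ← ENNReal.ofReal_coe_nnreal]
    refine ENNReal.ofReal_le_ofReal (hB.trans ?_)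
    calc Real.exp ((t - s) * n) = Real.exp (t * n) * Real.exp (-(s * n)) := by
          rw [← Real.exp_add]
          ring_nf
      _ ≤ _ := by gcongr
  · intro W hW
    have hl := hlen W hW
    refine ⟨?_, by omega, mem_prefixes.1 (by rwa [hl])⟩
    rintro rfl
    simp at hl
    omega
  · intro V hV W hW hne
    refine disjoint_left.2 fun x hxV hxW => hne ?_
    rw [mem_cylinder_iff] at hxV hxW
    rw [← hxV, ← hxW, hlen V hV, hlen W hW]

/-- The mean Li-Yorke set contains a dense `G_δ` subset of the closure `E` of the points that are
eventually equal to `ω`. Smallness of the lower mean distance is a `G_δ` condition that holds on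
this dense set; largeness of the upper mean distance is a `G_δ` condition that is dense because
the words close to `ω` grow more slowly than all words. -/
theorem packingMeasure_meanLiYorkeSet_eq_top {A : Matrix (Fin K) (Fin K) ℕ}
    (hA : ∀ i j, A i j = 0 ∨ A i j = 1) (hirr : ∀ i j, ∃ r : ℕ, 0 < r ∧ 0 < (A ^ r) i j)
    {ω : FullShift K} (hω : ω ∈ sft A) {s : ℝ≥0} {t : ℝ} (hst : s < t)
    (hgrowth : ∃ᶠ n : ℕ in atTop, Real.exp (t * n) ≤ (prefixes (sft A) n).ncard) :
    packingMeasure s (meanLiYorkeSet A ω) = ⊤ := by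
  obtain ⟨t₂, hst₂, ht₂⟩ := exists_between hst
  obtain ⟨t₁, hst₁, ht₁⟩ := exists_between hst₂
  have ht₁0 : 0 < t₁ := lt_of_le_of_lt s.2 hst₁
  obtain ⟨δ, hδ, hnear⟩ := exists_ncard_nearWords_le ω ht₁0
  set E := closure (tailSet A ω) with hE
  have hlocal : ∀ W : List (Fin K), (cylinder W ∩ E).Nonempty →
      ∃ᶠ n : ℕ in atTop, Real.exp (t₂ * n) ≤ (prefixes (cylinder W ∩ E) n).ncard :=
    fun W hW => frequently_exp_le_ncard_prefixes hA hirr hω ht₂ hgrowth hW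
  let P : ℕ → Set (FullShift K) := fun N =>
    ⋃ n ≥ N, {y | orbitMean shift ω y n < 1 / ((N : ℝ) + 1)}
  let Q : ℕ → Set (FullShift K) := fun N => ⋃ n ≥ N, {y | δ < orbitMean shift ω y n}
  have hPo : ∀ N, IsOpen (P N) := fun N => isOpen_biUnion fun n _ =>
    isOpen_lt (continuous_orbitMean ω n) continuous_const
  have hQo : ∀ N, IsOpen (Q N) := fun N => isOpen_biUnion fun n _ =>
    isOpen_lt continuous_const (continuous_orbitMean ω n)
  have hPd : ∀ N, tailSet A ω ⊆ P N := by
    rintro N y ⟨-, M, hM⟩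
    have hev := (tendsto_orbitMean_of_eventually_eq hM).eventually_lt_const
      (Nat.one_div_pos_of_nat (n := N) (α := ℝ))
    obtain ⟨n, hn, hN⟩ := (hev.and (eventually_ge_atTop N)).exists
    exact mem_iUnion₂.2 ⟨n, hN, hn⟩
  have hQd : ∀ N, E ⊆ closure (E ∩ Q N) := by
    intro N x hx
    refine mem_closure_iff_cylinder.2 fun k => ?_
    have hgr := hlocal (x.take k) ⟨x, self_mem_cylinder_take x k, hx⟩
    obtain ⟨n, hn, hN⟩ := (hgr.and_eventually (eventually_ge_atTop (N + 1))).exists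
    have hnpos : (0 : ℝ) < n := by exact_mod_cast (by omega : 0 < n)
    by_contra hcon
    have hsub : prefixes (cylinder (x.take k) ∩ E) n ⊆ nearWords ω δ ∩ {W | W.length = n} := by
      rintro _ ⟨y, ⟨hy, hyE⟩, rfl⟩
      refine ⟨⟨y, by simp, ?_⟩, by simp⟩
      by_contra! hδy
      have hyQ : y ∈ Q N := mem_iUnion₂.2 ⟨n, by omega, by simpa using hδy⟩
      exact hcon ⟨y, ⟨hyE, hyQ⟩, mem_cylinder_take.1 hy⟩
    have h1 := hn.trans ((Nat.cast_le.2 (ncard_le_ncard hsub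
      ((finite_length_eq n).subset fun W hW => hW.2))).trans (hnear n))
    rw [Real.exp_le_exp] at h1
    nlinarith
  have hPQd : ∀ N, E ⊆ closure (E ∩ (P N ∩ Q N)) := by
    intro N x hx
    refine mem_closure_iff.2 fun U hU hxU => ?_
    obtain ⟨y, hyU, hyE, hyQ⟩ := mem_closure_iff.1 (hQd N hx) U hU hxU
    obtain ⟨z, ⟨hzU, hzQ⟩, hz⟩ := mem_closure_iff.1 hyE (U ∩ Q N) (hU.inter (hQo N)) ⟨hyU, hyQ⟩
    exact ⟨z, hzU, subset_closure hz, hPd N hz, hzQ⟩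
  have hωE : ω ∈ E := subset_closure ⟨hω, 0, fun _ _ => rfl⟩
  refine packingMeasure_eq_top_of_residual isClosed_closure ⟨ω, hωE⟩
    (fun N => (hPo N).inter (hQo N)) hPQd ?_
    fun W hW => packingPreLim_eq_top_of_growth (hst₁.trans ht₁) (hlocal W hW)
  rintro y ⟨hyE, hy⟩
  rw [mem_iInter] at hy
  refine ⟨closure_tailSet_subset A ω hyE,
    isMeanLiYorkePair_of_frequently hδ (fun ε hε => ?_) ?_⟩
  · obtain ⟨N₀, hN₀⟩ := exists_nat_one_div_lt hε
    refine frequently_atTop.2 fun N => ?_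
    obtain ⟨n, hn, hlt⟩ := mem_iUnion₂.1 (hy (max N N₀)).1
    refine ⟨n, (le_max_left _ _).trans hn, (le_of_lt hlt).trans (le_trans ?_ hN₀.le)⟩
    gcongr
    exact le_max_right _ _
  · refine frequently_atTop.2 fun N => ?_
    obtain ⟨n, hn, hlt⟩ := mem_iUnion₂.1 (hy N).2
    exact ⟨n, hn, le_of_lt hlt⟩

/-! ### Topological entropy as the growth rate of the number of words -/

theorem ereal_exp_coe_mul_natCast (s : ℝ) (n : ℕ) :
    EReal.exp ((s : EReal) * n) = ENNReal.ofReal (Real.exp (s * n)) := by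
  rw [← EReal.exp_coe]
  simp

theorem ncard_prefixes_le_coverMincard (Z : Set (FullShift K)) (n : ℕ) :
    ((prefixes Z n).ncard : ℕ∞) ≤
      Dynamics.coverMincard shift Z {p : FullShift K × FullShift K | p.1 0 = p.2 0} n := by
  refine le_iInf₂ fun S hS => ?_
  have hsub : prefixes Z n ⊆ (fun x : FullShift K => x.take n) '' (S : Set (FullShift K)) := by
    rintro _ ⟨x, hx, rfl⟩
    obtain ⟨y, hy, hxy⟩ := hS hx
    refine ⟨y, hy, FullShift.take_eq_take.2 fun i hi => ?_⟩
    have : (shift^[i] x) 0 = (shift^[i] y) 0 := Dynamics.mem_dynEntourage.1 hxy i hi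
    rw [shift_iterate_apply, shift_iterate_apply] at this
    exact this.symm
  refine Nat.cast_le.2 ((ncard_le_ncard hsub (S.finite_toSet.image _)).trans ?_)
  exact (ncard_image_le S.finite_toSet).trans_eq (ncard_coe_finset S)

theorem coverMincard_le_ncard_prefixes (Z : Set (FullShift K)) {ε : ℝ} {k : ℕ}
    (hk : ∀ x y : FullShift K, (∀ i < k, x i = y i) → dist x y < ε) (n : ℕ) :
    Dynamics.coverMincard shift Z {p : FullShift K × FullShift K | dist p.1 p.2 < ε} n ≤
      ((prefixes Z (n + k)).ncard : ℕ∞) := by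
  classical
  have hex : ∀ W : prefixes Z (n + k), ∃ x ∈ Z, x.take (n + k) = W := fun W => W.2
  choose f hfZ hf using hex
  have := (finite_prefixes Z (n + k)).fintype
  have hcov : Dynamics.IsDynCoverOf shift Z
      {p : FullShift K × FullShift K | dist p.1 p.2 < ε} n (Finset.univ.image f) := by
    intro x hx
    refine ⟨f ⟨x.take (n + k), x, hx, rfl⟩, by simp, ?_⟩
    have hagree := FullShift.take_eq_take.1 (hf ⟨x.take (n + k), x, hx, rfl⟩)
    refine Dynamics.mem_dynEntourage.2 fun i hi => hk _ _ fun j hj => ?_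
    refine (shift_iterate_apply i x j).trans (Eq.trans ?_ (shift_iterate_apply i _ j).symm)
    exact (hagree (i + j) (by omega)).symm
  refine hcov.coverMincard_le_card.trans (Nat.cast_le.2 (Finset.card_image_le.trans ?_))
  rw [Finset.card_univ, ← Nat.card_eq_fintype_card]
  rfl

theorem eventually_ncard_prefixes_le {Z : Set (FullShift K)} {s : ℝ}
    (h : Dynamics.coverEntropy (shift : FullShift K → FullShift K) Z < s) :
    ∀ᶠ n : ℕ in atTop, ((prefixes Z n).ncard : ℝ) ≤ Real.exp (s * n) := by
  have hU : {p : FullShift K × FullShift K | p.1 0 = p.2 0} ∈ uniformity (FullShift K) :=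
    Metric.mem_uniformity_dist.2
      ⟨1, one_pos, fun {x y} hxy => FullShift.agree_of_dist_lt (n := 0) (by simpa using hxy) 0
        one_pos⟩
  have h1 := ExpGrowth.eventually_le_exp
    ((Dynamics.coverEntropyEntourage_le_coverEntropy shift Z hU).trans_lt h)
  filter_upwards [h1] with n hn
  have h2 := (ENat.toENNReal_le.2 (ncard_prefixes_le_coverMincard Z n)).trans hn
  rw [ereal_exp_coe_mul_natCast, ENat.toENNReal_coe] at h2
  rwa [← ENNReal.ofReal_natCast, ENNReal.ofReal_le_ofReal_iff (Real.exp_pos _).le] at h2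

theorem frequently_le_ncard_prefixes {Z : Set (FullShift K)} {t : ℝ}
    (h : (t : EReal) < Dynamics.coverEntropy (shift : FullShift K → FullShift K) Z) :
    ∃ᶠ n : ℕ in atTop, Real.exp (t * n) ≤ (prefixes Z n).ncard := by
  obtain ⟨t', htt', ht'⟩ := EReal.lt_iff_exists_real_btwn.1 h
  rw [EReal.coe_lt_coe_iff] at htt'
  rw [Dynamics.coverEntropy_eq_iSup_basis Metric.uniformity_basis_dist] at ht'
  obtain ⟨ε, ht'⟩ := lt_iSup_iff.1 ht'
  obtain ⟨hε, ht'⟩ := lt_iSup_iff.1 ht'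
  obtain ⟨k, hk⟩ := FullShift.exists_agree_dist_lt K hε
  have h1 := ExpGrowth.frequently_exp_le ht'
  have hlarge : ∀ᶠ n : ℕ in atTop, t * k ≤ (t' - t) * n :=
    (tendsto_natCast_atTop_atTop.const_mul_atTop (by linarith)).eventually_ge_atTop _
  refine frequently_atTop.2 fun N => ?_
  obtain ⟨n, ⟨hn, hn1⟩, hN⟩ :=
    ((h1.and_eventually hlarge).and_eventually (eventually_ge_atTop N)).exists
  refine ⟨n + k, by omega, ?_⟩
  have h2 := hn.trans (ENat.toENNReal_le.2 (coverMincard_le_ncard_prefixes Z hk n))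
  rw [ereal_exp_coe_mul_natCast, ENat.toENNReal_coe, ← ENNReal.ofReal_natCast,
    ENNReal.ofReal_le_ofReal_iff (Nat.cast_nonneg _)] at h2
  refine le_trans (Real.exp_le_exp.2 ?_) h2
  push_cast
  linarith

/-- Lower bounds for critical exponents: if `p` fails at every exponent below the growth rate of
the words, then the infimum of the exponents with `p` is at least the topological entropy. -/
theorem coverEntropy_le_iInf {Z : Set (FullShift K)} {p : ℝ≥0 → Prop}
    (H : ∀ s t : ℝ≥0, p s → (s : ℝ) < t →
      ¬ ∃ᶠ n : ℕ in atTop, Real.exp (t * n) ≤ (prefixes Z n).ncard) :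
    Dynamics.coverEntropy (shift : FullShift K → FullShift K) Z ≤
      ((⨅ (s : ℝ≥0) (_ : p s), (s : ℝ≥0∞) : ℝ≥0∞) : EReal) := by
  by_contra! hlt
  obtain ⟨t, ht1, ht2⟩ := EReal.lt_iff_exists_real_btwn.1 hlt
  have ht0 : 0 ≤ t := by
    have := (EReal.coe_ennreal_nonneg _).trans ht1.le
    exact_mod_cast this
  lift t to ℝ≥0 using ht0
  rw [← EReal.coe_nnreal_eq_coe_real, EReal.coe_ennreal_lt_coe_ennreal_iff] at ht1
  obtain ⟨s, hs⟩ := iInf_lt_iff.1 ht1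
  obtain ⟨hp, hst⟩ := iInf_lt_iff.1 hs
  exact H s t hp (by exact_mod_cast hst) (frequently_le_ncard_prefixes ht2)

/-! ### Entropies of invariant sets and of the mean Li-Yorke set -/

/-- A finite cover of an invariant set by cylinders with `∑ e^{-s|W|} ≤ 1` bounds the number of
words: splitting off the covering word at the beginning of a word of length `n` gives a word of
smaller length, so the count satisfies a renewal inequality. -/
theorem exists_ncard_prefixes_le {Z : Set (FullShift K)} (hZ : MapsTo shift Z Z) {s : ℝ≥0}
    {T : Finset (List (Fin K))} (hpos : ∀ W ∈ T, 0 < W.length)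
    (hcov : Z ⊆ ⋃ W ∈ T, cylinder W)
    (hsum : ∑ W ∈ T, Real.exp (-((s : ℝ) * W.length)) ≤ 1) :
    ∃ C : ℝ, ∀ n : ℕ, ((prefixes Z n).ncard : ℝ) ≤ C * Real.exp (s * n) := by
  classical
  set M := T.sup List.length with hM
  set C : ℝ := ∑ n ∈ Finset.range M, ((prefixes Z n).ncard : ℝ) with hC
  have hC0 : 0 ≤ C := Finset.sum_nonneg fun _ _ => Nat.cast_nonneg _
  refine ⟨C, fun n => ?_⟩
  induction n using Nat.strong_induction_on with
  | _ n ih =>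
  rcases Nat.lt_or_ge n M with hn | hn
  · have h1 : ((prefixes Z n).ncard : ℝ) ≤ C :=
      Finset.single_le_sum (f := fun n => ((prefixes Z n).ncard : ℝ))
        (fun _ _ => Nat.cast_nonneg _) (Finset.mem_range.2 hn)
    exact h1.trans (le_mul_of_one_le_right hC0 (Real.one_le_exp (by positivity)))
  · have hlen : ∀ W ∈ T, W.length ≤ n := fun W hW => (Finset.le_sup (f := List.length) hW).trans hn
    have hsub : prefixes Z n ⊆ ⋃ W ∈ T, (W ++ ·) '' prefixes Z (n - W.length) := by
      rintro _ ⟨x, hx, rfl⟩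
      obtain ⟨W, hW, hxW⟩ := mem_iUnion₂.1 (hcov hx)
      have hWn := hlen W hW
      refine mem_iUnion₂.2 ⟨W, hW, (shift^[W.length] x).take (n - W.length),
        ⟨_, hZ.iterate W.length hx, rfl⟩, ?_⟩
      rw [mem_cylinder_iff] at hxW
      refine List.ext_getElem (by simp; omega) fun i h1 h2 => ?_
      rcases Nat.lt_or_ge i W.length with hi | hi
      · have h3 := List.getElem_of_eq hxW (i := i) (by simpa using hi)
        simp only [FullShift.take, List.getElem_ofFn] at h3
        simp [FullShift.take, hi, h3]
      · simp [FullShift.take, List.getElem_append, hi.not_gt, shift_iterate_apply,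
          Nat.add_sub_cancel' hi]
    have hcard : (prefixes Z n).ncard ≤ ∑ W ∈ T, (prefixes Z (n - W.length)).ncard := by
      refine (ncard_le_ncard hsub (T.finite_toSet.biUnion fun W _ =>
        (finite_prefixes Z _).image _)).trans ?_
      refine (Finset.set_ncard_biUnion_le T _).trans (Finset.sum_le_sum fun W _ => ?_)
      exact ncard_image_le (finite_prefixes Z _)
    calc ((prefixes Z n).ncard : ℝ) ≤ ∑ W ∈ T, ((prefixes Z (n - W.length)).ncard : ℝ) := by
          exact_mod_cast hcard
      _ ≤ ∑ W ∈ T, C * Real.exp (s * n) * Real.exp (-((s : ℝ) * W.length)) := by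
          refine Finset.sum_le_sum fun W hW => ?_
          have h1 := hpos W hW
          have h2 := hlen W hW
          refine (ih (n - W.length) (by omega)).trans_eq ?_
          rw [mul_assoc, ← Real.exp_add, Nat.cast_sub h2]
          ring_nf
      _ = C * Real.exp (s * n) * ∑ W ∈ T, Real.exp (-((s : ℝ) * W.length)) := by
          rw [Finset.mul_sum]
      _ ≤ C * Real.exp (s * n) := mul_le_of_le_one_right (by positivity) hsum

/-- On a closed invariant set the topological entropy is at most the Bowen entropy. -/
theorem coverEntropy_le_bowenEntropy {Z : Set (FullShift K)} (hZc : IsClosed Z)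
    (hZ : MapsTo shift Z Z) :
    Dynamics.coverEntropy (shift : FullShift K → FullShift K) Z ≤ (bowenEntropy Z : EReal) := by
  refine coverEntropy_le_iInf fun s t hs0 hst' hgrowth => ?_
  have hpre : bowenPre s 0 Z < 1 := by
    have : bowenPre s 0 Z ≤ 0 := hs0 ▸ le_iSup (fun N => bowenPre s N Z) 0
    exact this.trans_lt one_pos
  obtain ⟨𝒲, h𝒲⟩ := iInf_lt_iff.1 hpre
  obtain ⟨hlen, h𝒲⟩ := iInf_lt_iff.1 h𝒲
  obtain ⟨hcov, hsum⟩ := iInf_lt_iff.1 h𝒲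
  obtain ⟨T, hT𝒲, hTfin, hT⟩ := hZc.isCompact.elim_finite_subcover_image
    (fun W _ => isOpen_cylinder W) hcov
  lift T to Finset (List (Fin K)) using hTfin
  have hTsum : ∑ W ∈ T, Real.exp (-((s : ℝ) * W.length)) ≤ 1 := by
    have h1 := (wordSum_mono s hT𝒲).trans hsum.le
    rw [wordSum, Finset.tsum_subtype' T
      (fun W : List (Fin K) => ENNReal.ofReal (Real.exp (-((s : ℝ) * W.length)))),
      ← ENNReal.ofReal_sum_of_nonneg fun _ _ => (Real.exp_pos _).le] at h1
    exact ENNReal.ofReal_le_one.1 h1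
  obtain ⟨C, hC⟩ := exists_ncard_prefixes_le hZ (fun W hW => hlen W (hT𝒲 hW)) hT hTsum
  have hlarge : ∀ᶠ n : ℕ in atTop, C < Real.exp ((t - s) * n) :=
    (Real.tendsto_exp_atTop.comp
      (tendsto_natCast_atTop_atTop.const_mul_atTop (by linarith))).eventually_gt_atTop C
  obtain ⟨n, hn, hn1⟩ := (hgrowth.and_eventually hlarge).exists
  have h1 : Real.exp (t * n) < Real.exp (t * n) :=
    calc Real.exp (t * n) ≤ C * Real.exp (s * n) := hn.trans (hC n)
      _ < Real.exp ((t - s) * n) * Real.exp (s * n) := by gcongr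
      _ = Real.exp (t * n) := by
          rw [← Real.exp_add]
          ring_nf
  exact lt_irrefl _ h1

theorem coe_le_coverEntropy_of_forall {Z : Set (FullShift K)} (hne : Z.Nonempty) {h : ℝ≥0∞}
    (H : ∀ s : ℝ≥0, (∀ᶠ n : ℕ in atTop, ((prefixes Z n).ncard : ℝ) ≤ Real.exp (s * n)) →
      h ≤ s) :
    (h : EReal) ≤ Dynamics.coverEntropy (shift : FullShift K → FullShift K) Z := by
  refine le_of_forall_gt_imp_ge_of_dense fun c hc => ?_
  obtain ⟨s, hs1, hs2⟩ := EReal.lt_iff_exists_real_btwn.1 hc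
  have hs0 : 0 ≤ s := by
    have := (Dynamics.coverEntropy_nonneg shift hne).trans hs1.le
    exact_mod_cast this
  lift s to ℝ≥0 using hs0
  have h1 := H s (eventually_ncard_prefixes_le hs1)
  rw [← EReal.coe_ennreal_le_coe_ennreal_iff, EReal.coe_nnreal_eq_coe_real] at h1
  exact h1.trans hs2.le

theorem mapsTo_shift_sft (A : Matrix (Fin K) (Fin K) ℕ) :
    MapsTo shift (sft A) (sft A) := fun _ hx => mapsTo_shift_iterate_sft A 1 hx

theorem bowenEntropy_sft {A : Matrix (Fin K) (Fin K) ℕ} (hne : (sft A).Nonempty) :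
    (bowenEntropy (sft A) : EReal) =
      Dynamics.coverEntropy (shift : FullShift K → FullShift K) (sft A) :=
  le_antisymm (coe_le_coverEntropy_of_forall hne fun _ h => bowenEntropy_le_of_growth h)
    (coverEntropy_le_bowenEntropy (isClosed_sft A) (mapsTo_shift_sft A))

theorem packingEntropy_meanLiYorkeSet {A : Matrix (Fin K) (Fin K) ℕ}
    (hA : ∀ i j, A i j = 0 ∨ A i j = 1) (hirr : ∀ i j, ∃ r : ℕ, 0 < r ∧ 0 < (A ^ r) i j)
    {ω : FullShift K} (hω : ω ∈ sft A) :
    (packingEntropy (meanLiYorkeSet A ω) : EReal) =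
      Dynamics.coverEntropy (shift : FullShift K → FullShift K) (sft A) := by
  refine le_antisymm (coe_le_coverEntropy_of_forall ⟨ω, hω⟩ fun s h =>
    (packingEntropy_mono fun _ hy => hy.1).trans (packingEntropy_le_of_growth h)) ?_
  refine coverEntropy_le_iInf fun s t hs0 hst hgrowth => ?_
  rw [packingMeasure_meanLiYorkeSet_eq_top hA hirr hω hst hgrowth] at hs0
  exact ENNReal.top_ne_zero hs0

/-! ### Dimensions are entropies divided by `log K` -/

/-- `log K` as a nonnegative real number, the ratio between entropies and dimensions. -/
noncomputable def logCard (K : ℕ) : ℝ≥0 := ⟨Real.log K, Real.log_natCast_nonneg K⟩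

theorem logCard_ne_zero (hK : 1 < K) : logCard K ≠ 0 := by
  have : 0 < Real.log K := Real.log_pos (by exact_mod_cast hK)
  exact fun h => this.ne' (congrArg NNReal.toReal h)

theorem exp_neg_logCard_mul (hK : 0 < K) (d : ℝ≥0) (n : ℕ) :
    Real.exp (-(((logCard K * d : ℝ≥0) : ℝ) * n)) = (((K : ℝ) ^ n)⁻¹) ^ (d : ℝ) := by
  have hK' : (0 : ℝ) < K := by exact_mod_cast hK
  rw [Real.rpow_def_of_pos (by positivity), Real.log_inv, Real.log_pow]
  congr 1
  push_cast
  change -(Real.log K * d * n) = _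
  ring

/-- At every scale `0 < r < 1` closeness up to `r` is agreement on a number `n` of symbols,
where `K ^ (-n)` is comparable to `r`. -/
theorem exists_dist_le_iff_agree (hK : 1 < K) {r : ℝ} (hr0 : 0 < r) (hr1 : r < 1) :
    ∃ n : ℕ, ((K : ℝ) ^ n)⁻¹ ≤ r ∧ r < K * ((K : ℝ) ^ n)⁻¹ ∧
      ∀ x y : FullShift K, dist x y ≤ r ↔ ∀ i < n, x i = y i := by
  have hK' : (1 : ℝ) < K := by exact_mod_cast hK
  have hK0 : (0 : ℝ) < K := by linarith
  obtain ⟨n, hn1, hn2⟩ := exists_nat_pow_near (one_le_inv₀ hr0 |>.2 hr1.le) hK'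
  rcases hn1.lt_or_eq with hlt | heq
  · have h1 : r < ((K : ℝ) ^ n)⁻¹ := (lt_inv_comm₀ (by positivity) hr0).1 hlt
    have h2 : ((K : ℝ) ^ (n + 1))⁻¹ ≤ r := (inv_le_comm₀ hr0 (by positivity)).1 hn2.le
    refine ⟨n + 1, h2, ?_, fun x y => ⟨fun h => ?_, fun h => ?_⟩⟩
    · refine h1.trans_eq ?_
      rw [pow_succ]
      field_simp
    · exact FullShift.agree_of_dist_lt (h.trans_lt h1)
    · exact (FullShift.dist_le_of_agree h).trans h2
  · have h1 : ((K : ℝ) ^ n)⁻¹ = r := by rw [heq, inv_inv]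
    refine ⟨n, h1.le, ?_, fun x y => ⟨fun h i hi => ?_, fun h => ?_⟩⟩
    · rw [h1]
      nlinarith
    · obtain ⟨m, rfl⟩ : ∃ m, n = m + 1 := ⟨n - 1, by omega⟩
      refine FullShift.agree_of_dist_lt (h.trans_lt ?_) i hi
      rw [← h1]
      gcongr
      omega
    · exact (FullShift.dist_le_of_agree h).trans h1.le

theorem packingPre_le_ballPackingPre (hK : 1 < K) (d : ℝ≥0) {N : ℕ} {δ : ℝ}
    (hN : ((K : ℝ) ^ N)⁻¹ ≤ δ) (Z : Set (FullShift K)) :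
    packingPre (logCard K * d) N Z ≤ ballPackingPre d δ Z := by
  have hK1 : (1 : ℝ) < K := by exact_mod_cast hK
  have hK0 : (0 : ℝ) < K := by linarith
  refine iSup₂_le fun 𝒲 h𝒲 => iSup_le fun hdisj => ?_
  have hex : ∀ W : 𝒲, ∃ x, x ∈ cylinder (W : List (Fin K)) ∩ Z := fun W => (h𝒲 W W.2).2.2
  choose c hc using hex
  let g : 𝒲 → FullShift K × ℝ := fun W => (c W, ((K : ℝ) ^ (W : List (Fin K)).length)⁻¹)
  have hball : ∀ W : 𝒲, Metric.closedBall (g W).1 (g W).2 ⊆ cylinder (W : List (Fin K)) := by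
    intro W x hx
    have hcW := mem_cylinder_iff.1 (hc W).1
    obtain ⟨m, hm⟩ : ∃ m, (W : List (Fin K)).length = m + 1 :=
      ⟨_, (Nat.succ_pred (List.length_pos_iff.2 (h𝒲 W W.2).1).ne').symm⟩
    rw [mem_cylinder_iff, ← hcW, FullShift.length_take, FullShift.take_eq_take, hm]
    refine FullShift.agree_of_dist_lt (lt_of_le_of_lt (Metric.mem_closedBall.1 hx) ?_)
    change ((K : ℝ) ^ (W : List (Fin K)).length)⁻¹ < _
    rw [hm]
    gcongr
    omega
  have hpos : ∀ W : 𝒲, 0 < (g W).2 := fun W => inv_pos.2 (pow_pos hK0 _)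
  have hginj : Function.Injective g := by
    intro V W h
    by_contra hne
    have hd := hdisj V.2 W.2 (fun e => hne (Subtype.ext e))
    refine disjoint_left.1 hd (hc V).1 ?_
    rw [show c V = c W from congrArg Prod.fst h]
    exact (hc W).1
  refine le_trans ?_ (le_iSup₂_of_le (range g) (countable_range g)
    (le_iSup₂_of_le ?_ ?_ le_rfl))
  · rw [wordSum, tsum_range (fun p : FullShift K × ℝ => ENNReal.ofReal ((2 * p.2) ^ (d : ℝ))) hginj]
    refine ENNReal.tsum_le_tsum fun W => ENNReal.ofReal_le_ofReal ?_
    rw [exp_neg_logCard_mul (by omega)]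
    refine Real.rpow_le_rpow (hpos W).le ?_ d.2
    change (g W).2 ≤ 2 * (g W).2
    linarith [hpos W]
  · rintro _ ⟨W, rfl⟩
    refine ⟨(hc W).2, hpos W, le_trans ?_ hN⟩
    change ((K : ℝ) ^ (W : List (Fin K)).length)⁻¹ ≤ _
    gcongr
    · exact hK1.le
    · exact (h𝒲 W W.2).2.1
  · rintro _ ⟨V, rfl⟩ _ ⟨W, rfl⟩ hne
    exact (hdisj V.2 W.2 fun e => hne (congrArg g (Subtype.ext e))).mono (hball V) (hball W)

theorem ballPackingPre_le_packingPre (hK : 1 < K) (d : ℝ≥0) {N : ℕ} {δ : ℝ}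
    (hN : δ < ((K : ℝ) ^ N)⁻¹) (Z : Set (FullShift K)) :
    ballPackingPre d δ Z ≤
      ENNReal.ofReal ((2 * K : ℝ) ^ (d : ℝ)) * packingPre (logCard K * d) N Z := by
  have hK1 : (1 : ℝ) < K := by exact_mod_cast hK
  have hK0 : (0 : ℝ) < K := by linarith
  refine iSup₂_le fun P _ => iSup₂_le fun hP hdisj => ?_
  have hN1 : ((K : ℝ) ^ N)⁻¹ ≤ 1 := inv_le_one_of_one_le₀ (one_le_pow₀ hK1.le)
  have hex : ∀ p : P, ∃ n : ℕ, ((K : ℝ) ^ n)⁻¹ ≤ p.1.2 ∧ p.1.2 < K * ((K : ℝ) ^ n)⁻¹ ∧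
      ∀ x y : FullShift K, dist x y ≤ p.1.2 ↔ ∀ i < n, x i = y i := fun p =>
    exists_dist_le_iff_agree hK (hP p p.2).2.1 (by linarith [(hP p p.2).2.2])
  choose n hn1 hn2 hn3 using hex
  let g : P → List (Fin K) := fun p => p.1.1.take (n p)
  have hlen : ∀ p, (g p).length = n p := fun p => FullShift.length_take _ _
  have hball : ∀ p : P, cylinder (g p) ⊆ Metric.closedBall p.1.1 p.1.2 := fun p x hx =>
    (hn3 p x p.1.1).2 (mem_cylinder_take.1 hx)
  have hnN : ∀ p, N < n p := by
    intro p
    have h1 : ((K : ℝ) ^ n p)⁻¹ < ((K : ℝ) ^ N)⁻¹ := by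
      linarith [(hP p p.2).2.2, hn1 p]
    exact (pow_lt_pow_iff_right₀ hK1).1 ((inv_lt_inv₀ (by positivity) (by positivity)).1 h1)
  have hgdisj : ∀ p q : P, p ≠ q → Disjoint (cylinder (g p)) (cylinder (g q)) := fun p q hne =>
    (hdisj p.2 q.2 fun e => hne (Subtype.ext e)).mono (hball p) (hball q)
  have hmem : ∀ p : P, p.1.1 ∈ cylinder (g p) := fun p => self_mem_cylinder_take _ _
  have hginj : Function.Injective g := by
    intro p q h
    by_contra hne
    exact disjoint_left.1 (hgdisj p q hne) (hmem p) (h ▸ hmem p)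
  have hle : wordSum (logCard K * d) (range g) ≤ packingPre (logCard K * d) N Z := by
    refine le_iSup₂_of_le (range g) ?_ (le_iSup_of_le ?_ le_rfl)
    · rintro _ ⟨p, rfl⟩
      refine ⟨fun h => ?_, ?_, p.1.1, hmem p, (hP p p.2).1⟩
      · have h1 := hlen p
        rw [h, List.length_nil] at h1
        have := hnN p
        omega
      · rw [hlen]
        exact (hnN p).le
    · rintro _ ⟨p, rfl⟩ _ ⟨q, rfl⟩ hne
      exact hgdisj p q fun e => hne (congrArg g e)
  refine le_trans ?_ (mul_le_mul_right hle _)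
  rw [wordSum, tsum_range (fun W : List (Fin K) => ENNReal.ofReal
    (Real.exp (-(((logCard K * d : ℝ≥0) : ℝ) * W.length)))) hginj, ← ENNReal.tsum_mul_left]
  refine ENNReal.tsum_le_tsum fun p => ?_
  rw [← ENNReal.ofReal_mul (by positivity), exp_neg_logCard_mul (by omega), hlen,
    ← Real.mul_rpow (by positivity) (by positivity)]
  have h0 := (hP p p.2).2.1
  refine ENNReal.ofReal_le_ofReal (Real.rpow_le_rpow (by positivity) ?_ d.2)
  nlinarith [hn2 p]

theorem packingPreLim_le_ballPackingPreLim (hK : 1 < K) (d : ℝ≥0) (Z : Set (FullShift K)) :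
    packingPreLim (logCard K * d) Z ≤ ballPackingPreLim d Z := by
  have hK1 : (1 : ℝ) < K := by exact_mod_cast hK
  refine le_iInf₂ fun δ hδ => ?_
  obtain ⟨N, hN⟩ := exists_pow_lt_of_lt_one hδ (inv_lt_one_of_one_lt₀ hK1)
  rw [inv_pow] at hN
  exact (iInf_le _ N).trans (packingPre_le_ballPackingPre hK d hN.le Z)

theorem ballPackingPreLim_le_packingPreLim (hK : 1 < K) (d : ℝ≥0) (Z : Set (FullShift K)) :
    ballPackingPreLim d Z ≤
      ENNReal.ofReal ((2 * K : ℝ) ^ (d : ℝ)) * packingPreLim (logCard K * d) Z := by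
  have hK0 : (0 : ℝ) < K := by exact_mod_cast (by omega : 0 < K)
  rw [packingPreLim, ENNReal.mul_iInf_of_ne (by positivity) ENNReal.ofReal_ne_top]
  refine le_iInf fun N => ?_
  have hpos : 0 < ((K : ℝ) ^ N)⁻¹ := by positivity
  exact (iInf₂_le _ (half_pos hpos)).trans
    (ballPackingPre_le_packingPre hK d (half_lt_self hpos) Z)

theorem ballPackingMeasure_eq_zero_iff (hK : 1 < K) (d : ℝ≥0) (Z : Set (FullShift K)) :
    ballPackingMeasure d Z = 0 ↔ packingMeasure (logCard K * d) Z = 0 := by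
  have hK0 : (0 : ℝ) < K := by exact_mod_cast (by omega : 0 < K)
  have h1 : packingMeasure (logCard K * d) Z ≤ ballPackingMeasure d Z :=
    iInf₂_mono fun C _ => ENNReal.tsum_le_tsum fun i =>
      packingPreLim_le_ballPackingPreLim hK d (C i)
  have h2 : ballPackingMeasure d Z ≤
      ENNReal.ofReal ((2 * K : ℝ) ^ (d : ℝ)) * packingMeasure (logCard K * d) Z := by
    have hc : ENNReal.ofReal ((2 * K : ℝ) ^ (d : ℝ)) ≠ 0 := by positivity
    simp only [packingMeasure, ENNReal.mul_iInf_of_ne hc ENNReal.ofReal_ne_top]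
    refine iInf₂_mono fun C _ => ?_
    rw [← ENNReal.tsum_mul_left]
    exact ENNReal.tsum_le_tsum fun i => ballPackingPreLim_le_packingPreLim hK d (C i)
  constructor <;> intro h
  · exact le_antisymm (h1.trans_eq h) zero_le
  · exact le_antisymm (h2.trans_eq (by rw [h, mul_zero])) zero_le

theorem iInf_coe_eq_mul_iInf {L : ℝ≥0} (hL : L ≠ 0) {p q : ℝ≥0 → Prop}
    (h : ∀ d, q d ↔ p (L * d)) :
    ⨅ (s : ℝ≥0) (_ : p s), (s : ℝ≥0∞) = L * ⨅ (d : ℝ≥0) (_ : q d), (d : ℝ≥0∞) := by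
  have hL' : (L : ℝ≥0∞) ≠ 0 := by exact_mod_cast hL
  simp only [ENNReal.mul_iInf_of_ne hL' ENNReal.coe_ne_top, h]
  refine ((Equiv.mulLeft₀ L hL).iInf_congr fun d => ?_).symm
  simp

theorem packingEntropy_eq_mul_dimP (hK : 1 < K) (Z : Set (FullShift K)) :
    packingEntropy Z = logCard K * dimP Z :=
  iInf_coe_eq_mul_iInf (logCard_ne_zero hK) fun d => ballPackingMeasure_eq_zero_iff hK d Z

theorem ediam_cylinder_le (W : List (Fin K)) :
    Metric.ediam (cylinder W) ≤ ENNReal.ofReal ((K : ℝ) ^ W.length)⁻¹ := by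
  refine Metric.ediam_le fun x hx y hy => ?_
  rw [edist_dist]
  refine ENNReal.ofReal_le_ofReal (FullShift.dist_le_of_agree ?_)
  rw [mem_cylinder_iff] at hx hy
  exact FullShift.take_eq_take.1 (hx.trans hy.symm)

/-- A small set is contained in a cylinder whose weight exceeds the power of the diameter by an
arbitrarily small amount. The error term is needed for sets of diameter `0`. -/
theorem exists_subset_cylinder (hK : 1 < K) (d : ℝ≥0) (N : ℕ) {t : Set (FullShift K)}
    (ht : t.Nonempty) (hdiam : Metric.ediam t ≤ ENNReal.ofReal ((K : ℝ) ^ (N + 1))⁻¹)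
    {ε : ℝ≥0∞} (hε : 0 < ε) :
    ∃ W : List (Fin K), N < W.length ∧ t ⊆ cylinder W ∧
      ENNReal.ofReal (Real.exp (-(((logCard K * d : ℝ≥0) : ℝ) * W.length))) ≤
        Metric.ediam t ^ (d : ℝ) + ε := by
  have hK1 : (1 : ℝ) < K := by exact_mod_cast hK
  have hK0 : (0 : ℝ) < K := by linarith
  obtain ⟨x, hx⟩ := ht
  suffices ∃ n : ℕ, N < n ∧ (∀ y ∈ t, ∀ i < n, y i = x i) ∧
      ENNReal.ofReal (Real.exp (-(((logCard K * d : ℝ≥0) : ℝ) * n))) ≤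
        Metric.ediam t ^ (d : ℝ) + ε by
    obtain ⟨n, h1, h2, h3⟩ := this
    exact ⟨x.take n, by simpa using h1, fun y hy => mem_cylinder_take.2 (h2 y hy), by
      simpa using h3⟩
  rcases eq_or_ne (Metric.ediam t) 0 with h0 | h0
  · have hsub : ∀ y ∈ t, y = x := fun y hy => Metric.ediam_eq_zero_iff.1 h0 hy hx
    rcases eq_or_ne d 0 with rfl | hd
    · exact ⟨N + 1, by omega, fun y hy i _ => by rw [hsub y hy], by simp⟩
    · have hLd : 0 < ((logCard K * d : ℝ≥0) : ℝ) :=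
        NNReal.coe_pos.2 (pos_iff_ne_zero.2 (mul_ne_zero (logCard_ne_zero hK) hd))
      have hlim : Tendsto (fun n : ℕ => ENNReal.ofReal
          (Real.exp (-(((logCard K * d : ℝ≥0) : ℝ) * n)))) atTop (𝓝 0) := by
        rw [← ENNReal.ofReal_zero]
        refine ENNReal.tendsto_ofReal (Real.tendsto_exp_neg_atTop_nhds_zero.comp ?_)
        exact tendsto_natCast_atTop_atTop.const_mul_atTop hLd
      obtain ⟨n, hn, hN⟩ := ((hlim.eventually_lt_const hε).and (eventually_gt_atTop N)).exists
      exact ⟨n, hN, fun y hy i _ => by rw [hsub y hy], hn.le.trans le_add_self⟩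
  · have htop : Metric.ediam t ≠ ⊤ := ne_top_of_le_ne_top ENNReal.ofReal_ne_top hdiam
    set r := (Metric.ediam t).toReal with hr
    have hr0 : 0 < r := ENNReal.toReal_pos h0 htop
    have hrN : r ≤ ((K : ℝ) ^ (N + 1))⁻¹ := ENNReal.toReal_le_of_le_ofReal (by positivity) hdiam
    have hr1 : r < 1 := hrN.trans_lt (inv_lt_one_of_one_lt₀ (one_lt_pow₀ hK1 (by omega)))
    obtain ⟨n, hn1, hn2, hn3⟩ := exists_dist_le_iff_agree hK hr0 hr1
    refine ⟨n, ?_, fun y hy => (hn3 y x).1 ?_, ?_⟩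
    · have h1 := (inv_le_inv₀ (by positivity) (by positivity)).1 (hn1.trans hrN)
      exact (pow_le_pow_iff_right₀ hK1).1 h1
    · have h1 := Metric.edist_le_ediam_of_mem hy hx
      rw [edist_dist] at h1
      exact (ENNReal.ofReal_le_iff_le_toReal htop).1 h1
    · rw [exp_neg_logCard_mul (by omega)]
      refine le_trans ?_ (le_add_right le_rfl)
      rw [← ENNReal.ofReal_toReal htop, ENNReal.ofReal_rpow_of_pos hr0]
      exact ENNReal.ofReal_le_ofReal (Real.rpow_le_rpow (by positivity) hn1 d.2)

open MeasureTheory in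
theorem hausdorffMeasure_eq_zero_iff [MeasurableSpace (FullShift K)] [BorelSpace (FullShift K)]
    (hK : 1 < K) (d : ℝ≥0) (Z : Set (FullShift K)) :
    μH[d] Z = 0 ↔ bowenMeasure (logCard K * d) Z = 0 := by
  have hK1 : (1 : ℝ) < K := by exact_mod_cast hK
  have hK0 : (0 : ℝ) < K := by linarith
  constructor
  · intro h
    refine le_antisymm (iSup_le fun N => ?_) zero_le
    refine ENNReal.le_of_forall_pos_le_add fun ε hε _ => ?_
    have hε' : (0 : ℝ≥0∞) < ε := by exact_mod_cast hε
    obtain ⟨η, hη, hηsum⟩ := ENNReal.exists_pos_sum_of_countable (ENNReal.half_pos hε'.ne').ne' ℕ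
    rw [Measure.hausdorffMeasure_apply] at h
    have hr : 0 < ENNReal.ofReal ((K : ℝ) ^ (N + 1))⁻¹ := ENNReal.ofReal_pos.2 (by positivity)
    have h1 := (le_iSup₂ (f := fun (r : ℝ≥0∞) (_ : 0 < r) =>
      ⨅ (t : ℕ → Set (FullShift K)) (_ : Z ⊆ ⋃ n, t n) (_ : ∀ n, Metric.ediam (t n) ≤ r),
        ∑' n, ⨆ _ : (t n).Nonempty, Metric.ediam (t n) ^ (d : ℝ)) _ hr).trans_eq h
    have h2 := h1.trans_lt (ENNReal.half_pos hε'.ne')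
    obtain ⟨t, h2⟩ := iInf_lt_iff.1 h2
    obtain ⟨hcov, h2⟩ := iInf_lt_iff.1 h2
    obtain ⟨hdiam, hsum⟩ := iInf_lt_iff.1 h2
    have hex : ∀ n, ∃ W : List (Fin K), (t n).Nonempty → N < W.length ∧ t n ⊆ cylinder W ∧
        ENNReal.ofReal (Real.exp (-(((logCard K * d : ℝ≥0) : ℝ) * W.length))) ≤
          Metric.ediam (t n) ^ (d : ℝ) + η n := by
      intro n
      by_cases hne : (t n).Nonempty
      · obtain ⟨W, hW⟩ := exists_subset_cylinder hK d N hne (hdiam n)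
          (ε := η n) (by exact_mod_cast hη n)
        exact ⟨W, fun _ => hW⟩
      · exact ⟨[], fun h => absurd h hne⟩
    choose w hw using hex
    rw [zero_add]
    refine iInf_le_of_le (⋃ n, {W | (t n).Nonempty ∧ W = w n}) (iInf₂_le_of_le ?_ ?_ ?_)
    · intro W hW
      obtain ⟨n, hne, rfl⟩ := mem_iUnion.1 hW
      exact (hw n hne).1
    · intro x hx
      obtain ⟨n, hn⟩ := mem_iUnion.1 (hcov hx)
      exact mem_iUnion₂.2 ⟨w n, mem_iUnion.2 ⟨n, ⟨x, hn⟩, rfl⟩, (hw n ⟨x, hn⟩).2.1 hn⟩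
    · calc _ ≤ ∑' n, wordSum (logCard K * d) {W | (t n).Nonempty ∧ W = w n} :=
            ENNReal.tsum_iUnion_le_tsum (fun W : List (Fin K) => ENNReal.ofReal
              (Real.exp (-(((logCard K * d : ℝ≥0) : ℝ) * W.length)))) _
        _ ≤ ∑' n, ((⨆ _ : (t n).Nonempty, Metric.ediam (t n) ^ (d : ℝ)) + η n) := by
            refine ENNReal.tsum_le_tsum fun n => ?_
            by_cases hne : (t n).Nonempty
            · have hs : {W | (t n).Nonempty ∧ W = w n} = {w n} := by
                ext W
                simp [hne]
              rw [hs, iSup_pos hne, wordSum, tsum_singleton (w n) (fun W : List (Fin K) =>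
                ENNReal.ofReal (Real.exp (-(((logCard K * d : ℝ≥0) : ℝ) * W.length))))]
              exact (hw n hne).2.2
            · have hs : {W | (t n).Nonempty ∧ W = w n} = ∅ := by
                ext W
                simp [hne]
              rw [hs]
              simp [wordSum]
        _ = (∑' n, ⨆ _ : (t n).Nonempty, Metric.ediam (t n) ^ (d : ℝ)) +
              ∑' n, (η n : ℝ≥0∞) := ENNReal.tsum_add
        _ ≤ ε / 2 + ε / 2 := add_le_add hsum.le hηsum.le
        _ = ε := ENNReal.add_halves _
  · intro h
    refine le_antisymm (ENNReal.le_of_forall_pos_le_add fun ε hε _ => ?_) zero_le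
    have hε' : (0 : ℝ≥0∞) < ε := by exact_mod_cast hε
    have hex : ∀ N, ∃ 𝒲 : Set (List (Fin K)), (∀ W ∈ 𝒲, N < W.length) ∧
        Z ⊆ ⋃ W ∈ 𝒲, cylinder W ∧ wordSum (logCard K * d) 𝒲 ≤ ε := by
      intro N
      have h1 : bowenPre (logCard K * d) N Z < ε :=
        ((le_iSup (fun N => bowenPre (logCard K * d) N Z) N).trans_eq h).trans_lt hε'
      obtain ⟨𝒲, h1⟩ := iInf_lt_iff.1 h1
      obtain ⟨hlen, h1⟩ := iInf_lt_iff.1 h1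
      obtain ⟨hcov, h1⟩ := iInf_lt_iff.1 h1
      exact ⟨𝒲, hlen, hcov, h1.le⟩
    choose 𝒲 hlen hcov hsum using hex
    have hr : Tendsto (fun N : ℕ => ENNReal.ofReal ((K : ℝ) ^ N)⁻¹) atTop (𝓝 0) := by
      rw [← ENNReal.ofReal_zero]
      refine ENNReal.tendsto_ofReal ?_
      exact tendsto_inv_atTop_zero.comp (tendsto_pow_atTop_atTop_of_one_lt hK1)
    refine (Measure.hausdorffMeasure_le_liminf_tsum d Z _ hr
      (fun N (W : 𝒲 N) => cylinder (W : List (Fin K))) (Eventually.of_forall fun N W => ?_)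
      (Eventually.of_forall fun N => ?_)).trans ?_
    · refine (ediam_cylinder_le _).trans (ENNReal.ofReal_le_ofReal ?_)
      gcongr
      · exact hK1.le
      · exact (hlen N W W.2).le
    · rw [← biUnion_eq_iUnion (𝒲 N) fun W _ => cylinder W]
      exact hcov N
    · rw [zero_add]
      refine liminf_le_of_frequently_le' (Frequently.of_forall fun N => le_trans ?_ (hsum N))
      refine ENNReal.tsum_le_tsum fun W => ?_
      rw [exp_neg_logCard_mul (by omega), ← ENNReal.ofReal_rpow_of_pos (by positivity)]
      exact ENNReal.rpow_le_rpow (ediam_cylinder_le _) d.2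

theorem bowenEntropy_eq_mul_dimH (hK : 1 < K) (Z : Set (FullShift K)) :
    bowenEntropy Z = logCard K * dimH Z := by
  borelize (FullShift K)
  rw [dimH_eq_iInf]
  exact iInf_coe_eq_mul_iInf (logCard_ne_zero hK) fun d => hausdorffMeasure_eq_zero_iff hK d Z

/-! ### The mean Li-Yorke set over a single symbol -/

theorem dimP_empty {X : Type*} [MetricSpace X] : dimP (∅ : Set X) = 0 := by
  suffices h : ballPackingMeasure 0 (∅ : Set X) = 0 from
    le_antisymm (iInf₂_le_of_le 0 h (by simp)) zero_le
  refine le_antisymm ?_ zero_le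
  refine iInf₂_le_of_le (fun _ => ∅) (empty_subset _) ?_
  have : ballPackingPreLim 0 (∅ : Set X) = 0 := by
    refine le_antisymm (iInf₂_le_of_le 1 one_pos ?_) zero_le
    refine iSup₂_le fun P _ => iSup₂_le fun hP _ => ?_
    have : P = ∅ := eq_empty_of_forall_notMem fun p hp => (hP p hp).1
    subst this
    simp
  simp [this]

theorem meanLiYorkeSet_eq_empty [Subsingleton (FullShift K)] (A : Matrix (Fin K) (Fin K) ℕ)
    (ω : FullShift K) : meanLiYorkeSet A ω = ∅ := by
  refine eq_empty_of_forall_notMem fun y hy => ?_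
  have h := tendsto_orbitMean_of_eventually_eq (ω := ω) (y := y) (M := 0)
    fun i _ => by rw [Subsingleton.elim y ω]
  have := hy.2.2
  rw [h.limsup_eq] at this
  exact lt_irrefl _ this

end SymbolicSpace

theorem theorem1p2 (K : ℕ) (A : Matrix (Fin K) (Fin K) ℕ)
    (hA : ∀ i j, A i j = 0 ∨ A i j = 1)
    (hirr : ∀ i j, ∃ r : ℕ, 0 < r ∧ 0 < (A ^ r) i j)
    (ω : FullShift K) (hω : ω ∈ sft A) :
    bowenEntropy (meanLiYorkeSet A ω) = 0 ∧
    ((packingEntropy (meanLiYorkeSet A ω) : ℝ≥0∞) : EReal)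
      = Dynamics.coverEntropy (shift : FullShift K → FullShift K) (sft A) ∧
    dimH (meanLiYorkeSet A ω) = 0 ∧
    dimP (meanLiYorkeSet A ω) = dimH (sft A) := by
  have hB := bowenEntropy_meanLiYorkeSet A ω
  have hP := packingEntropy_meanLiYorkeSet hA hirr hω
  refine ⟨hB, hP, ?_⟩
  rcases Nat.lt_or_ge 1 K with hK | hK
  · have hL : ((logCard K : ℝ≥0) : ℝ≥0∞) ≠ 0 := by exact_mod_cast logCard_ne_zero hK
    rw [← bowenEntropy_sft ⟨ω, hω⟩, EReal.coe_ennreal_eq_coe_ennreal_iff,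
      packingEntropy_eq_mul_dimP hK, bowenEntropy_eq_mul_dimH hK,
      ENNReal.mul_right_inj hL ENNReal.coe_ne_top] at hP
    rw [bowenEntropy_eq_mul_dimH hK] at hB
    exact ⟨(mul_eq_zero.1 hB).resolve_left hL, hP⟩
  · -- Over one symbol `log K = 0` and the shift is a single point.
    have : Subsingleton (FullShift K) :=
      ⟨fun x y => funext fun i => Fin.ext (by have := (x i).2; have := (y i).2; omega)⟩
    rw [meanLiYorkeSet_eq_empty, dimP_empty, dimH_empty,
      dimH_subsingleton Set.subsingleton_of_subsingleton]
    exact ⟨rfl, rfl⟩
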